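/- A permutation $\sigma$ of $\{1,\dots,n\}$ is \emph{sortable} by a machine if, starting from the input sequence $\sigma(1),\sigma(2),\dots,\sigma(n)$, the machine can produce the output sequence $1,2,\dots,n$. We consider two machines, both initially and finally empty, each having two input operations $I_1,I_2$, which remove the next element of the input and insert it in the machine, and two output operations $O_1,O_2$, which remove an element from the machine and append it to the output. For \emph{two stacks in parallel} (2sip), $I_j$ pushes onto the top of the $j$-th stack and $O_j$ pops the top of the $j$-th stack ($j=1,2$). For a \emph{deque}, $I_1$ and $O_1$ insert and remove at the top, $I_2$ and $O_2$ at the bottom. Let $p_n$ and $d_n$ be the numbers of permutations of length $n$ that are sortable by two stacks in parallel and by a deque, respectively. A \emph{walk} is a finite sequence of steps $N=(0,1)$, $E=(1,0)$, $S=(0,-1)$, $W=(-1,0)$, starting at the origin. It is \emph{eager} if no $E$ step is immediately followed by an $S$ step and no $N$ step is immediately followed by a $W$ step. A \emph{QP-subloop} of a walk is a nonempty section of consecutive steps that starts and ends at the same point $(p,q)$ and visits only points $(x,y)$ with $x\ge p$ and $y\ge q$; a walk is \emph{standard} if each of its QP-subloops begins with an $N$ step. A \emph{big-walk} is a standard and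 eager walk confined to the half-plane $\{(x,y): x+y\ge 0\}$ that ends on the line $x+y=0$. Let $b_n$ be the number of big-walks of length $2n$. \textbf{Theorem.} The exponential growth rates $$\mu_p=\lim_{n\to\infty}\sqrt[n]{p_n},\qquad \mu_d=\lim_{n\to\infty}\sqrt[n]{d_n},\qquad \mu_b=\lim_{n\to\infty}\sqrt[n]{b_n}$$ exist, are finite, and are all equal. -/

import Mathlib

/-!
# Permutations sortable by two stacks in parallel or by a deque, and big-walks
-/

namespace SortingMachines

/-! ### Two stacks in parallel -/

/-- A configuration of the machine consisting of two stacks in parallel: the remaining input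
(next element first), the two stacks (top element first) and the output (oldest element first). -/
structure TwoStackConfig (α : Type) where
  input : List α
  stack₁ : List α
  stack₂ : List α
  output : List α

/-- The four operations `I₁`, `I₂`, `O₁`, `O₂` of two stacks in parallel. -/
inductive TwoStackStep {α : Type} : TwoStackConfig α → TwoStackConfig α → Prop
  | I₁ (a : α) (i s t o : List α) : TwoStackStep ⟨a :: i, s, t, o⟩ ⟨i, a :: s, t, o⟩
  | I₂ (a : α) (i s t o : List α) : TwoStackStep ⟨a :: i, s, t, o⟩ ⟨i, s, a :: t, o⟩
  | O₁ (a : α) (i s t o : List α) : TwoStackStep ⟨i, a :: s, t, o⟩ ⟨i, s, t, o ++ [a]⟩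
  | O₂ (a : α) (i s t o : List α) : TwoStackStep ⟨i, s, a :: t, o⟩ ⟨i, s, t, o ++ [a]⟩

/-- A permutation `σ` of `{0, …, n - 1}` is sortable by two stacks in parallel if, from the input
`σ 0, σ 1, …, σ (n - 1)`, the machine can produce the output `0, 1, …, n - 1`. -/
def TwoStackSortable {n : ℕ} (σ : Equiv.Perm (Fin n)) : Prop :=
  Relation.ReflTransGen TwoStackStep
    (⟨List.ofFn σ, [], [], []⟩ : TwoStackConfig (Fin n)) ⟨[], [], [], List.finRange n⟩

/-- The number `p n` of 2sip-sortable permutations of length `n`. -/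
noncomputable def numTwoStackSortable (n : ℕ) : ℕ :=
  Nat.card {σ : Equiv.Perm (Fin n) // TwoStackSortable σ}

/-! ### The deque -/

/-- A configuration of a deque machine: the remaining input (next element first), the content of
the deque (from top to bottom) and the output (oldest element first). -/
structure DequeConfig (α : Type) where
  input : List α
  deque : List α
  output : List α

/-- The four operations of a deque: `I₁` and `O₁` act at the top, `I₂` and `O₂` at the bottom. -/
inductive DequeStep {α : Type} : DequeConfig α → DequeConfig α → Prop
  | I₁ (a : α) (i d o : List α) : DequeStep ⟨a :: i, d, o⟩ ⟨i, a :: d, o⟩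
  | I₂ (a : α) (i d o : List α) : DequeStep ⟨a :: i, d, o⟩ ⟨i, d ++ [a], o⟩
  | O₁ (a : α) (i d o : List α) : DequeStep ⟨i, a :: d, o⟩ ⟨i, d, o ++ [a]⟩
  | O₂ (a : α) (i d o : List α) : DequeStep ⟨i, d ++ [a], o⟩ ⟨i, d, o ++ [a]⟩

/-- A permutation `σ` of `{0, …, n - 1}` is sortable by a deque if, from the input
`σ 0, σ 1, …, σ (n - 1)`, the machine can produce the output `0, 1, …, n - 1`. -/
def DequeSortable {n : ℕ} (σ : Equiv.Perm (Fin n)) : Prop :=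
  Relation.ReflTransGen DequeStep
    (⟨List.ofFn σ, [], []⟩ : DequeConfig (Fin n)) ⟨[], [], List.finRange n⟩

/-- The number `d n` of deque-sortable permutations of length `n`. -/
noncomputable def numDequeSortable (n : ℕ) : ℕ :=
  Nat.card {σ : Equiv.Perm (Fin n) // DequeSortable σ}

/-! ### Big-walks -/

/-- The unit steps north, east, south and west. -/
inductive Step
  | N
  | E
  | S
  | W

/-- The displacement of a step. -/
def Step.vec : Step → ℤ × ℤ
  | .N => (0, 1)
  | .E => (1, 0)
  | .S => (0, -1)
  | .W => (-1, 0)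

/-- A walk starting at the origin is given by its list of steps; this is its final point. The points
visited by `w` are the final points of the prefixes of `w`. -/
def endpoint (w : List Step) : ℤ × ℤ := (w.map Step.vec).sum

/-- A walk is eager if it contains no `ES` and no `NW` corner. -/
def IsEager (w : List Step) : Prop :=
  ¬ [Step.E, Step.S] <:+: w ∧ ¬ [Step.N, Step.W] <:+: w

/-- A quarter-plane excursion: a walk from the origin to itself inside `{(x, y) | x, y ≥ 0}`. -/
def IsQPExcursion (v : List Step) : Prop :=
  endpoint v = (0, 0) ∧ ∀ u, u <+: v → 0 ≤ (endpoint u).1 ∧ 0 ≤ (endpoint u).2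

/-- A walk is standard if each of its (nonempty) QP-subloops begins with a north step. A QP-subloop
is a section of the walk that starts and ends at some point `(p, q)` and visits only points `(x, y)`
with `x ≥ p` and `y ≥ q`, which means that its steps, taken from the origin, form a quarter-plane
excursion. -/
def IsStandard (w : List Step) : Prop :=
  ∀ v, v <:+: w → v ≠ [] → IsQPExcursion v → v.head? = some Step.N

/-- A big-walk is a standard and eager walk from the origin, confined to the half-plane
`{(x, y) | x + y ≥ 0}`, that ends on the line `x + y = 0`. -/
structure IsBigWalk (w : List Step) : Prop where
  halfPlane : ∀ u, u <+: w → 0 ≤ (endpoint u).1 + (endpoint u).2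
  ends : (endpoint w).1 + (endpoint w).2 = 0
  standard : IsStandard w
  eager : IsEager w

/-- The number `b n` of big-walks of length `2 * n`. -/
noncomputable def numBigWalks (n : ℕ) : ℕ :=
  Nat.card {w : List Step // w.length = 2 * n ∧ IsBigWalk w}

end SortingMachines

/-!
The numbers `p n`, `d n`, `b n` satisfy `p n ≤ d n ≤ b n ≤ 2 * μ ^ n`, where `μ` is the growth rate of
`p n`; it exists by Fekete's lemma, because direct sums of sortable permutations are sortable.

The first inequality holds since two stacks joined at their bottoms form a deque. For the second one,
read `N`, `E`, `S`, `W` as `I₁`, `I₂`, `O₁`, `O₂`. Among the walks that make a deque sort a given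
permutation, the lexicographically smallest one is a big-walk (`DequeRun.exists_isBigWalk`): a corner
`ES` or `NW` or a quarter-plane subloop that begins with `E` could be replaced by something smaller.

For the third inequality, the key is that a standard eager walk, read as operations of two stacks in
parallel, is determined by its effect. Eagerness determines the pattern of input and output operations
(`TwoStackRun.map_isInput_eq_of_isEager`), and given this pattern, standardness determines which stack
is used (`TwoStackRun.eq_of_isStandard`): if two runs with the same effect push some element on
different stacks, then the elements inserted since have to leave the machine before the older ones
(`TwoStackRun.exists_returns`), so there is a subloop, and in one of the two walks it begins with `E`.

It follows that standard eager quarter-plane excursions inject into the permutations sortable by two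
stacks in parallel (`card_le_numTwoStackSortable`), and that reflecting big-walks and making them
standard again is injective (`exists_reflection`). At least half of the big-walks of half-length `m`
therefore end on a given side of the origin. Concatenating `M` of these, each reflected if this is
needed to stay near the diagonal, and adding a beginning and an end of lengths that depend only on `m`
gives standard eager quarter-plane excursions. Hence `(b m / 2) ^ M ≤ p (m * M + 8 * m + 2)` for all
`M`, which gives `b m / 2 ≤ μ ^ m`.
-/

namespace SortingMachines

/-! ### Recursive descriptions of walks -/

/-- Whether a step, read as an operation of a machine, is an input operation. -/
def Step.isInput : Step → Bool
  | .N => true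
  | .E => true
  | .S => false
  | .W => false

/-- The reflection of a step in the line `x = y`; it exchanges the two stacks. -/
def Step.flip : Step → Step
  | .N => .E
  | .E => .N
  | .S => .W
  | .W => .S

/-- An encoding of the steps by numbers, which orders them by `S < W < N < E`. Each rewriting of
walks used below decreases the first letter that it changes with respect to this order. -/
def Step.code : Step → ℕ
  | .S => 0
  | .W => 1
  | .N => 2
  | .E => 3

theorem Step.code_injective : Function.Injective Step.code := by
  intro a b; cases a <;> cases b <;> simp [Step.code]

instance : Finite Step :=
  Finite.of_injective (β := Fin 4) (fun a => ⟨a.code, by cases a <;> simp [Step.code]⟩)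
    fun a b h => Step.code_injective (by simpa using h)

theorem map_isInput_flip (w : List Step) : (w.map Step.flip).map Step.isInput = w.map Step.isInput := by
  rw [List.map_map]
  refine List.map_congr_left fun a _ => ?_
  cases a <;> rfl

theorem map_code_append_lt (u : List Step) {z z' : List Step}
    (h : z.map Step.code < z'.map Step.code) :
    (u ++ z).map Step.code < (u ++ z').map Step.code := by
  induction u with
  | nil => exact h
  | cons x u ih => simpa using ih

/-- `Returns v x y` says that the walk `v`, started at the point `(x, y)` of the quarter plane, stays
in the quarter plane and ends at the origin. -/
def Returns : List Step → ℕ → ℕ → Prop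
  | [], x, y => x = 0 ∧ y = 0
  | .N :: v, x, y => Returns v x (y + 1)
  | .E :: v, x, y => Returns v (x + 1) y
  | .S :: v, x, y => ∃ y', y = y' + 1 ∧ Returns v x y'
  | .W :: v, x, y => ∃ x', x = x' + 1 ∧ Returns v x' y

/-- `Balanced l h` says that the path with up steps `true` and down steps `false`, started at height
`h`, never goes below height `0` and ends at height `0`. -/
def Balanced : List Bool → ℕ → Prop
  | [], h => h = 0
  | true :: l, h => Balanced l (h + 1)
  | false :: l, h => ∃ h', h = h' + 1 ∧ Balanced l h'

@[simp] theorem endpoint_nil : endpoint [] = 0 := rfl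

@[simp] theorem endpoint_cons (a : Step) (w : List Step) :
    endpoint (a :: w) = a.vec + endpoint w := by
  simp [endpoint]

theorem forall_prefix_cons {α : Type*} {P : List α → Prop} {a : α} {w : List α} :
    (∀ u, u <+: a :: w → P u) ↔ P [] ∧ ∀ u, u <+: w → P (a :: u) := by
  constructor
  · intro h
    exact ⟨h _ (List.nil_prefix), fun u hu => h _ (List.cons_prefix_cons.2 ⟨rfl, hu⟩)⟩
  · rintro ⟨h0, h1⟩ u hu
    cases u with
    | nil => exact h0
    | cons b u =>
      obtain ⟨rfl, hu'⟩ := List.cons_prefix_cons.1 hu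
      exact h1 u hu'

theorem returns_iff (v : List Step) (x y : ℕ) :
    Returns v x y ↔ ((x + (endpoint v).1 = 0 ∧ y + (endpoint v).2 = 0) ∧
      ∀ u, u <+: v → 0 ≤ x + (endpoint u).1 ∧ 0 ≤ y + (endpoint u).2) := by
  induction v generalizing x y with
  | nil => simp [Returns]
  | cons a v ih =>
    rw [forall_prefix_cons]
    cases a
    · simp only [Returns, ih, endpoint_cons, Step.vec, Prod.fst_add, Prod.snd_add, endpoint_nil,
        Prod.fst_zero, Prod.snd_zero]
      push_cast
      simp only [zero_add, add_assoc]
      refine and_congr_right fun _ => ⟨fun h => ⟨by omega, h⟩, fun h => h.2⟩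
    · simp only [Returns, ih, endpoint_cons, Step.vec, Prod.fst_add, Prod.snd_add, endpoint_nil,
        Prod.fst_zero, Prod.snd_zero]
      push_cast
      simp only [zero_add, add_assoc]
      refine and_congr_right fun _ => ⟨fun h => ⟨by omega, h⟩, fun h => h.2⟩
    · simp only [Returns, ih, endpoint_cons, Step.vec, Prod.fst_add, Prod.snd_add, endpoint_nil,
        Prod.fst_zero, Prod.snd_zero]
      constructor
      · rintro ⟨y', rfl, h1, h2⟩
        refine ⟨by push_cast; omega, by omega, fun u hu => ?_⟩
        have := h2 u hu
        push_cast; omega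
      · rintro ⟨h1, h0, h2⟩
        have h3 := h2 [] List.nil_prefix
        simp at h3
        refine ⟨y - 1, by omega, by omega, fun u hu => ?_⟩
        have := h2 u hu
        omega
    · simp only [Returns, ih, endpoint_cons, Step.vec, Prod.fst_add, Prod.snd_add, endpoint_nil,
        Prod.fst_zero, Prod.snd_zero]
      constructor
      · rintro ⟨y', rfl, h1, h2⟩
        refine ⟨by push_cast; omega, by omega, fun u hu => ?_⟩
        have := h2 u hu
        push_cast; omega
      · rintro ⟨h1, h0, h2⟩
        have h3 := h2 [] List.nil_prefix
        simp at h3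
        refine ⟨x - 1, by omega, by omega, fun u hu => ?_⟩
        have := h2 u hu
        omega

theorem isQPExcursion_iff (v : List Step) : IsQPExcursion v ↔ Returns v 0 0 := by
  simp [returns_iff, IsQPExcursion, Prod.ext_iff]

theorem balanced_iff (w : List Step) (h : ℕ) :
    Balanced (w.map Step.isInput) h ↔ (h + ((endpoint w).1 + (endpoint w).2) = 0 ∧
      ∀ u, u <+: w → 0 ≤ h + ((endpoint u).1 + (endpoint u).2)) := by
  induction w generalizing h with
  | nil => simp [Balanced]
  | cons a w ih =>
    rw [forall_prefix_cons]
    cases a <;>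
      simp only [List.map_cons, Step.isInput, Balanced, ih, endpoint_cons, Step.vec, Prod.fst_add,
        Prod.snd_add, endpoint_nil, Prod.fst_zero, Prod.snd_zero]
    · constructor
      · rintro ⟨h1, h2⟩
        exact ⟨by omega, by omega, fun u hu => by have := h2 u hu; omega⟩
      · rintro ⟨h1, h0, h2⟩
        exact ⟨by omega, fun u hu => by have := h2 u hu; omega⟩
    · constructor
      · rintro ⟨h1, h2⟩
        exact ⟨by omega, by omega, fun u hu => by have := h2 u hu; omega⟩
      · rintro ⟨h1, h0, h2⟩
        exact ⟨by omega, fun u hu => by have := h2 u hu; omega⟩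
    · constructor
      · rintro ⟨h', rfl, h1, h2⟩
        exact ⟨by omega, by omega, fun u hu => by have := h2 u hu; omega⟩
      · rintro ⟨h1, h0, h2⟩
        have h3 := h2 [] List.nil_prefix
        simp at h3
        exact ⟨h - 1, by omega, by omega, fun u hu => by have := h2 u hu; omega⟩
    · constructor
      · rintro ⟨h', rfl, h1, h2⟩
        exact ⟨by omega, by omega, fun u hu => by have := h2 u hu; omega⟩
      · rintro ⟨h1, h0, h2⟩
        have h3 := h2 [] List.nil_prefix
        simp at h3
        exact ⟨h - 1, by omega, by omega, fun u hu => by have := h2 u hu; omega⟩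

theorem isBigWalk_iff (w : List Step) :
    IsBigWalk w ↔ Balanced (w.map Step.isInput) 0 ∧ IsStandard w ∧ IsEager w := by
  rw [balanced_iff]
  constructor
  · rintro ⟨h1, h2, h3, h4⟩
    exact ⟨⟨by simpa using h2, by simpa using h1⟩, h3, h4⟩
  · rintro ⟨⟨h2, h1⟩, h3, h4⟩
    exact ⟨by simpa using h1, by simpa using h2, h3, h4⟩

theorem isEager_nil : IsEager [] := by simp [IsEager]

theorem isEager_cons (x : Step) (w : List Step) :
    IsEager (x :: w) ↔ (¬ (x = .E ∧ w.head? = some .S) ∧ ¬ (x = .N ∧ w.head? = some .W)) ∧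
      IsEager w := by
  have key (a b : Step) : [a, b] <+: x :: w ↔ x = a ∧ w.head? = some b := by
    cases w <;> simp [List.cons_prefix_cons, eq_comm]
  simp only [IsEager, List.infix_cons_iff, key]
  tauto

theorem isStandard_nil : IsStandard [] := by
  intro v hv h; simp_all

/-- A walk is standard if and only if no quarter-plane subloop begins with an east step; this can be
checked at the first step and in the rest of the walk. -/
theorem isStandard_cons (x : Step) (w : List Step) :
    IsStandard (x :: w) ↔ (x = .E → ∀ v, v <+: w → ¬ Returns v 1 0) ∧ IsStandard w := by
  simp only [IsStandard, List.infix_cons_iff]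
  constructor
  · intro h
    refine ⟨?_, fun v hv => h v (Or.inr hv)⟩
    rintro rfl v hv hr
    have := h (.E :: v) (Or.inl (List.cons_prefix_cons.2 ⟨rfl, hv⟩)) (by simp)
      ((isQPExcursion_iff _).2 hr)
    simp at this
  · rintro ⟨h1, h2⟩ v (hv | hv) hne hq
    · cases v with
      | nil => simp at hne
      | cons y v =>
        obtain ⟨rfl, hv'⟩ := List.cons_prefix_cons.1 hv
        rw [isQPExcursion_iff] at hq
        cases y
        · rfl
        · exact absurd hq (h1 rfl v hv')
        · simp [Returns] at hq
        · simp [Returns] at hq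
    · exact h2 v hv hne hq

/-! ### Concatenation of walks -/

theorem isEager_append_of_balanced {w z : List Step} {h : ℕ}
    (hb : Balanced (w.map Step.isInput) h) (hw : IsEager w) (hz : IsEager z) :
    IsEager (w ++ z) := by
  induction w generalizing h with
  | nil => exact hz
  | cons a w ih =>
    rw [isEager_cons] at hw
    have hb' : ∃ h', Balanced (w.map Step.isInput) h' := by
      cases a <;> simp only [List.map_cons, Step.isInput, Balanced] at hb
      exacts [⟨_, hb⟩, ⟨_, hb⟩, ⟨_, hb.choose_spec.2⟩, ⟨_, hb.choose_spec.2⟩]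
    obtain ⟨h', hb'⟩ := hb'
    rw [List.cons_append, isEager_cons]
    refine ⟨?_, ih hb' hw.2⟩
    cases w with
    | nil => cases a <;> simp [Step.isInput, Balanced] at hb ⊢
    | cons b w => simpa using hw.1

/-- A quarter-plane path that follows a balanced walk `a` of initial height at least `x + y` cannot
be longer than `a`, because at the end of `a` it has reached the origin. -/
theorem Returns.of_append {a b : List Step} {x y h : ℕ} (hr : Returns (a ++ b) x y)
    (hb : Balanced (a.map Step.isInput) h) (hxy : x + y ≤ h) : Returns a x y := by
  induction a generalizing x y h with
  | nil => simp only [List.map_nil, Balanced] at hb; exact ⟨by omega, by omega⟩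
  | cons s a ih =>
    cases s <;> simp only [List.cons_append, Returns, List.map_cons, Step.isInput, Balanced]
      at hr hb ⊢
    · exact ih hr hb (by omega)
    · exact ih hr hb (by omega)
    · obtain ⟨y', rfl, hr⟩ := hr
      obtain ⟨h', rfl, hb⟩ := hb
      exact ⟨_, rfl, ih hr hb (by omega)⟩
    · obtain ⟨x', rfl, hr⟩ := hr
      obtain ⟨h', rfl, hb⟩ := hb
      exact ⟨_, rfl, ih hr hb (by omega)⟩

theorem isStandard_append_of_balanced {w z : List Step} {h : ℕ}
    (hb : Balanced (w.map Step.isInput) h) (hw : IsStandard w) (hz : IsStandard z) :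
    IsStandard (w ++ z) := by
  induction w generalizing h with
  | nil => exact hz
  | cons a w ih =>
    rw [isStandard_cons] at hw
    rw [List.cons_append, isStandard_cons]
    cases a <;> simp only [List.map_cons, Step.isInput, Balanced] at hb
    · exact ⟨by simp, ih hb hw.2⟩
    · refine ⟨fun _ v hv hr => ?_, ih hb hw.2⟩
      rcases List.prefix_or_prefix_of_prefix hv (List.prefix_append w z) with hv | ⟨v', rfl⟩
      · exact hw.1 rfl v hv hr
      · exact hw.1 rfl w List.prefix_rfl (hr.of_append hb (by omega))
    · exact ⟨by simp, ih hb.choose_spec.2 hw.2⟩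
    · exact ⟨by simp, ih hb.choose_spec.2 hw.2⟩

theorem Balanced.length_eq {l : List Bool} {h : ℕ} (hb : Balanced l h) :
    2 * l.count true + h = l.length := by
  induction l generalizing h with
  | nil => simpa [Balanced] using hb
  | cons a l ih =>
    cases a <;> simp only [Balanced] at hb
    · obtain ⟨h', rfl, hb⟩ := hb
      have := ih hb
      simp; omega
    · have := ih hb
      simp; omega

/-! ### Deque-sortable permutations and big-walks -/

/-- `DequeRun w i o d` says that the operations `w`, with `N`, `E`, `S`, `W` read as `I₁`, `I₂`,
`O₁`, `O₂`, lead the deque from the content `d` to the empty deque while they consume exactly the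
input `i` and produce exactly the output `o`. -/
def DequeRun {α : Type*} : List Step → List α → List α → List α → Prop
  | [], i, o, d => i = [] ∧ o = [] ∧ d = []
  | .N :: w, i, o, d => ∃ a i', i = a :: i' ∧ DequeRun w i' o (a :: d)
  | .E :: w, i, o, d => ∃ a i', i = a :: i' ∧ DequeRun w i' o (d ++ [a])
  | .S :: w, i, o, d => ∃ a o' d', o = a :: o' ∧ d = a :: d' ∧ DequeRun w i o' d'
  | .W :: w, i, o, d => ∃ a o' d', o = a :: o' ∧ d = d' ++ [a] ∧ DequeRun w i o' d'

/-- The operations and the output determine the input: a run can be reconstructed from its end. -/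
theorem DequeRun.unique {α : Type*} {w : List Step} {i₁ i₂ o d₁ d₂ : List α}
    (h₁ : DequeRun w i₁ o d₁) (h₂ : DequeRun w i₂ o d₂) : i₁ = i₂ ∧ d₁ = d₂ := by
  induction w generalizing i₁ i₂ o d₁ d₂ with
  | nil => obtain ⟨rfl, -, rfl⟩ := h₁; obtain ⟨rfl, -, rfl⟩ := h₂; simp
  | cons x w ih =>
    cases x <;> simp only [DequeRun] at h₁ h₂
    · obtain ⟨a, i₁, rfl, h₁⟩ := h₁
      obtain ⟨b, i₂, rfl, h₂⟩ := h₂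
      have := ih h₁ h₂
      simp_all
    · obtain ⟨a, i₁, rfl, h₁⟩ := h₁
      obtain ⟨b, i₂, rfl, h₂⟩ := h₂
      obtain ⟨rfl, h⟩ := ih h₁ h₂
      have := List.append_inj' h rfl
      simp_all
    · obtain ⟨a, o', d₁, rfl, rfl, h₁⟩ := h₁
      obtain ⟨b, o', d₂, h, rfl, h₂⟩ := h₂
      simp only [List.cons.injEq] at h
      obtain ⟨rfl, rfl⟩ := h
      have := ih h₁ h₂
      simp_all
    · obtain ⟨a, o', d₁, rfl, rfl, h₁⟩ := h₁
      obtain ⟨b, o', d₂, h, rfl, h₂⟩ := h₂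
      simp only [List.cons.injEq] at h
      obtain ⟨rfl, rfl⟩ := h
      have := ih h₁ h₂
      simp_all

theorem DequeRun.balanced {α : Type*} {w : List Step} {i o d : List α} (h : DequeRun w i o d) :
    Balanced (w.map Step.isInput) d.length := by
  induction w generalizing i o d with
  | nil => simp_all [DequeRun, Balanced]
  | cons x w ih =>
    cases x <;> simp only [DequeRun] at h
    · obtain ⟨a, i, rfl, h⟩ := h
      simpa [Step.isInput, Balanced] using ih h
    · obtain ⟨a, i, rfl, h⟩ := h
      simpa [Step.isInput, Balanced] using ih h
    · obtain ⟨a, o', d, rfl, rfl, h⟩ := h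
      exact ⟨_, by simp, ih h⟩
    · obtain ⟨a, o', d, rfl, rfl, h⟩ := h
      exact ⟨_, by simp, ih h⟩

theorem DequeRun.length_eq {α : Type*} {w : List Step} {i o d : List α} (h : DequeRun w i o d) :
    w.length = i.length + o.length := by
  induction w generalizing i o d with
  | nil => simp_all [DequeRun]
  | cons x w ih =>
    cases x <;> simp only [DequeRun] at h
    · obtain ⟨a, i, rfl, h⟩ := h
      have := ih h; simp; omega
    · obtain ⟨a, i, rfl, h⟩ := h
      have := ih h; simp; omega
    · obtain ⟨a, o', d, rfl, rfl, h⟩ := h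
      have := ih h; simp; omega
    · obtain ⟨a, o', d, rfl, rfl, h⟩ := h
      have := ih h; simp; omega

/-- Reflecting a section that never touches the elements `d` below the top part `X` and above the
bottom part `Y`, and in the end has removed `X` and `Y`, does not change what the machine does. -/
theorem DequeRun.flip_section {α : Type*} {v z : List Step} {i o d X Y : List α}
    (hv : Returns v Y.length X.length) (h : DequeRun (v ++ z) i o (X ++ d ++ Y.reverse)) :
    DequeRun (v.map Step.flip ++ z) i o (Y ++ d ++ X.reverse) := by
  induction v generalizing i o X Y with
  | nil =>
    obtain ⟨h1, h2⟩ := hv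
    rw [List.length_eq_zero_iff] at h1 h2
    subst h1 h2
    simpa using h
  | cons x v ih =>
    cases x <;> simp only [DequeRun, List.cons_append, Returns, List.map_cons, Step.flip] at h hv ⊢
    · obtain ⟨a, i, rfl, h⟩ := h
      refine ⟨a, i, rfl, ?_⟩
      simpa using ih (X := a :: X) (Y := Y) hv (by simpa using h)
    · obtain ⟨a, i, rfl, h⟩ := h
      refine ⟨a, i, rfl, ?_⟩
      simpa using ih (X := X) (Y := a :: Y) hv (by simpa using h)
    · obtain ⟨a, o', d', rfl, h1, h⟩ := h
      obtain ⟨y', hy, hv⟩ := hv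
      obtain ⟨b, X, rfl⟩ := List.exists_cons_of_length_eq_add_one hy
      simp only [List.cons_append, List.cons.injEq] at h1
      obtain ⟨rfl, rfl⟩ := h1
      refine ⟨_, _, Y ++ d ++ X.reverse, rfl, by simp, ih ?_ h⟩
      convert hv using 1; simpa using hy
    · obtain ⟨a, o', d', rfl, h1, h⟩ := h
      obtain ⟨y', hy, hv⟩ := hv
      obtain ⟨b, Y, rfl⟩ := List.exists_cons_of_length_eq_add_one hy
      rw [List.reverse_cons, ← List.append_assoc] at h1
      obtain ⟨rfl, h2⟩ := List.append_inj' h1 rfl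
      simp only [List.cons.injEq, and_true] at h2
      subst h2
      refine ⟨_, _, Y ++ d ++ X.reverse, rfl, by simp, ih ?_ h⟩
      convert hv using 1; simpa using hy

/-- A decrease of the tail `z` of a walk with respect to the lexicographic order, possible for each
run of `z`, yields a decrease of the whole walk. -/
theorem DequeRun.descend {α : Type*} {u z : List Step} {i o d : List α}
    (hz : ∀ i o d : List α, DequeRun z i o d →
      ∃ z', z'.map Step.code < z.map Step.code ∧ DequeRun z' i o d)
    (h : DequeRun (u ++ z) i o d) :
    ∃ w', w'.map Step.code < (u ++ z).map Step.code ∧ DequeRun w' i o d := by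
  induction u generalizing i o d with
  | nil => exact hz i o d h
  | cons x u ih =>
    suffices ∃ w', w'.map Step.code < (u ++ z).map Step.code ∧ DequeRun (x :: w') i o d by
      obtain ⟨w', h1, h2⟩ := this
      exact ⟨x :: w', by simpa using h1, h2⟩
    cases x <;> simp only [DequeRun, List.cons_append] at h ⊢
    · obtain ⟨a, i, rfl, h⟩ := h
      obtain ⟨w', h1, h2⟩ := ih h
      exact ⟨w', h1, _, _, rfl, h2⟩
    · obtain ⟨a, i, rfl, h⟩ := h
      obtain ⟨w', h1, h2⟩ := ih h
      exact ⟨w', h1, _, _, rfl, h2⟩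
    · obtain ⟨a, o', d, rfl, rfl, h⟩ := h
      obtain ⟨w', h1, h2⟩ := ih h
      exact ⟨w', h1, _, _, _, rfl, rfl, h2⟩
    · obtain ⟨a, o', d, rfl, rfl, h⟩ := h
      obtain ⟨w', h1, h2⟩ := ih h
      exact ⟨w', h1, _, _, _, rfl, rfl, h2⟩

theorem isEager_of_forall {w : List Step} (h₁ : ∀ u z, w ≠ u ++ .E :: .S :: z)
    (h₂ : ∀ u z, w ≠ u ++ .N :: .W :: z) : IsEager w := by
  refine ⟨fun ⟨u, z, h⟩ => h₁ u z ?_, fun ⟨u, z, h⟩ => h₂ u z ?_⟩ <;> simp [← h]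

theorem isStandard_of_forall {w : List Step}
    (h : ∀ u v z, w = u ++ (.E :: v ++ z) → ¬ Returns v 1 0) : IsStandard w := by
  induction w with
  | nil => exact isStandard_nil
  | cons x w ih =>
    rw [isStandard_cons]
    refine ⟨?_, ih fun u v z hw => h (x :: u) v z (by simp [hw])⟩
    rintro rfl v ⟨z, rfl⟩
    exact h [] v z rfl

/-- Among the walks that make the deque produce the output `o` from the input `i`, the smallest one
in the lexicographic order is a big-walk. -/
theorem DequeRun.exists_isBigWalk {α : Type*} {w : List Step} {i o : List α}
    (h : DequeRun w i o []) : ∃ w', DequeRun w' i o [] ∧ IsBigWalk w' := by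
  have hfin : {w | DequeRun w i o []}.Finite :=
    (List.finite_length_eq Step (i.length + o.length)).subset fun w hw => DequeRun.length_eq hw
  obtain ⟨w', hw', hmin⟩ :=
    Set.exists_min_image _ (fun w : List Step => w.map Step.code) hfin ⟨w, h⟩
  have key (u z : List Step) (e : w' = u ++ z) : ¬ ∀ i o d : List α, DequeRun z i o d →
      ∃ z', z'.map Step.code < z.map Step.code ∧ DequeRun z' i o d := by
    intro hz
    subst e
    obtain ⟨w'', h1, h2⟩ := DequeRun.descend hz hw'
    exact absurd (hmin w'' h2) (not_le.2 h1)
  refine ⟨w', hw', (isBigWalk_iff _).2 ⟨hw'.balanced, ?_, ?_⟩⟩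
  · refine isStandard_of_forall fun u v z e hv => key u _ e ?_
    intro i o d h
    refine ⟨.N :: v.map Step.flip ++ z, ?_, ?_⟩
    · simp [List.cons_lt_cons_iff, Step.code]
    · simpa [Step.flip] using
        DequeRun.flip_section (v := .E :: v) (X := []) (Y := []) hv (by simpa using h)
  · -- An output that follows an input at the other end can be moved in front of it, unless the deque
    -- was empty before; in that case both ends are the same and the corner can be written as `NS`.
    refine isEager_of_forall (fun u z e => key u _ e ?_) (fun u z e => key u _ e ?_)
    · intro i o d h
      simp only [DequeRun] at h
      obtain ⟨a, i', rfl, b, o', d', rfl, h1, h⟩ := h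
      cases d with
      | nil =>
        simp only [List.nil_append, List.cons.injEq] at h1
        obtain ⟨rfl, rfl⟩ := h1
        exact ⟨.N :: .S :: z, by simp [List.cons_lt_cons_iff, Step.code],
          _, _, rfl, _, _, _, rfl, rfl, h⟩
      | cons c d =>
        simp only [List.cons_append, List.cons.injEq] at h1
        obtain ⟨rfl, rfl⟩ := h1
        exact ⟨.S :: .E :: z, by simp [List.cons_lt_cons_iff, Step.code],
          _, _, _, rfl, rfl, _, _, rfl, h⟩
    · intro i o d h
      simp only [DequeRun] at h
      obtain ⟨a, i', rfl, b, o', d', rfl, h1, h⟩ := h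
      rcases d.eq_nil_or_concat with rfl | ⟨d, c, rfl⟩
      · obtain ⟨rfl, h2⟩ := List.append_inj' (s₁ := []) h1 rfl
        simp only [List.cons.injEq, and_true] at h2
        subst h2
        exact ⟨.N :: .S :: z, by simp [List.cons_lt_cons_iff, Step.code],
          _, _, rfl, _, _, _, rfl, rfl, h⟩
      · rw [List.concat_eq_append] at h1 ⊢
        obtain ⟨rfl, h2⟩ := List.append_inj' (s₁ := a :: d) h1 rfl
        simp only [List.cons.injEq, and_true] at h2
        subst h2
        exact ⟨.W :: .N :: z, by simp [List.cons_lt_cons_iff, Step.code],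
          _, _, _, rfl, rfl, _, _, rfl, h⟩

theorem exists_dequeRun_of_reflTransGen {α : Type} {c c' : DequeConfig α}
    (h : Relation.ReflTransGen DequeStep c c') (hi : c'.input = []) (hd : c'.deque = []) :
    ∃ w o, DequeRun w c.input o c.deque ∧ c.output ++ o = c'.output := by
  induction h using Relation.ReflTransGen.head_induction_on with
  | refl => exact ⟨[], [], ⟨hi, rfl, hd⟩, by simp⟩
  | head h _ ih =>
    obtain ⟨w, o', h1, h2⟩ := ih
    cases h with
    | I₁ a i d o => exact ⟨.N :: w, o', ⟨_, _, rfl, h1⟩, h2⟩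
    | I₂ a i d o => exact ⟨.E :: w, o', ⟨_, _, rfl, h1⟩, h2⟩
    | O₁ a i d o => exact ⟨.S :: w, a :: o', ⟨_, _, _, rfl, rfl, h1⟩, by simpa using h2⟩
    | O₂ a i d o => exact ⟨.W :: w, a :: o', ⟨_, _, _, rfl, rfl, h1⟩, by simpa using h2⟩

instance (n : ℕ) : Finite {w : List Step // w.length = 2 * n ∧ IsBigWalk w} :=
  ((List.finite_length_eq Step (2 * n)).subset fun _ hw => hw.1 :
    {w : List Step | w.length = 2 * n ∧ IsBigWalk w}.Finite)

theorem numDequeSortable_le_numBigWalks (n : ℕ) : numDequeSortable n ≤ numBigWalks n := by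
  have key (σ : {σ : Equiv.Perm (Fin n) // DequeSortable σ}) :
      ∃ w : {w : List Step // w.length = 2 * n ∧ IsBigWalk w},
        DequeRun w.1 (List.ofFn σ.1) (List.finRange n) [] := by
    obtain ⟨w, o, h1, h2⟩ := exists_dequeRun_of_reflTransGen σ.2 rfl rfl
    simp only [List.nil_append] at h2
    subst h2
    obtain ⟨w', h3, h4⟩ := h1.exists_isBigWalk
    exact ⟨⟨w', by have := h3.length_eq; simp at this; omega, h4⟩, h3⟩
  choose f hf using key
  refine Nat.card_le_card_of_injective f fun σ τ h => ?_
  have h1 := hf σ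
  rw [h] at h1
  exact Subtype.ext (Equiv.coe_fn_injective (List.ofFn_injective (h1.unique (hf τ)).1))

/-! ### Simulation of two stacks in parallel by a deque -/

/-- Joining the two stacks at their bottoms turns them into a deque. -/
theorem TwoStackSortable.dequeSortable {n : ℕ} {σ : Equiv.Perm (Fin n)} (h : TwoStackSortable σ) :
    DequeSortable σ := by
  refine Relation.ReflTransGen.lift
    (fun c : TwoStackConfig (Fin n) =>
      (⟨c.input, c.stack₁ ++ c.stack₂.reverse, c.output⟩ : DequeConfig (Fin n))) ?_ _ _ h
  intro c c' hc
  cases hc with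
  | I₁ a i s t o => exact .I₁ a i _ o
  | I₂ a i s t o => simpa [Function.onFun] using DequeStep.I₂ a i (s ++ t.reverse) o
  | O₁ a i s t o => exact .O₁ a i _ o
  | O₂ a i s t o => simpa [Function.onFun] using DequeStep.O₂ a i (s ++ t.reverse) o

theorem numTwoStackSortable_le_numDequeSortable (n : ℕ) :
    numTwoStackSortable n ≤ numDequeSortable n :=
  Nat.card_le_card_of_injective (Subtype.map id fun _ h => h.dequeSortable)
    (Subtype.map_injective _ Function.injective_id)

/-! ### Runs of two stacks in parallel -/

/-- `TwoStackRun w i o s t s' t'` says that the operations `w`, with `N`, `E`, `S`, `W` read as `I₁`,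
`I₂`, `O₁`, `O₂`, lead two stacks in parallel from the contents `s`, `t` to the contents `s'`, `t'`
while they consume exactly the input `i` and produce exactly the output `o`. -/
def TwoStackRun {α : Type*} :
    List Step → List α → List α → List α → List α → List α → List α → Prop
  | [], i, o, s, t, s', t' => i = [] ∧ o = [] ∧ s = s' ∧ t = t'
  | .N :: w, i, o, s, t, s', t' => ∃ a i₁, i = a :: i₁ ∧ TwoStackRun w i₁ o (a :: s) t s' t'
  | .E :: w, i, o, s, t, s', t' => ∃ a i₁, i = a :: i₁ ∧ TwoStackRun w i₁ o s (a :: t) s' t'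
  | .S :: w, i, o, s, t, s', t' =>
    ∃ a o₁ s₁, o = a :: o₁ ∧ s = a :: s₁ ∧ TwoStackRun w i o₁ s₁ t s' t'
  | .W :: w, i, o, s, t, s', t' =>
    ∃ a o₁ t₁, o = a :: o₁ ∧ t = a :: t₁ ∧ TwoStackRun w i o₁ s t₁ s' t'

namespace TwoStackRun

variable {α β : Type*} {w w₁ w₂ u v z : List Step} {i o s t s' t' : List α}

theorem unique {o₁ o₂ s₁ s₂ t₁ t₂ : List α} (h₁ : TwoStackRun w i o₁ s t s₁ t₁)
    (h₂ : TwoStackRun w i o₂ s t s₂ t₂) : o₁ = o₂ ∧ s₁ = s₂ ∧ t₁ = t₂ := by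
  induction w generalizing i o₁ o₂ s t with
  | nil => obtain ⟨-, rfl, rfl, rfl⟩ := h₁; obtain ⟨-, rfl, rfl, rfl⟩ := h₂; simp
  | cons x w ih =>
    cases x <;> simp only [TwoStackRun] at h₁ h₂
    · obtain ⟨a, i₁, rfl, h₁⟩ := h₁
      obtain ⟨b, i₂, h, h₂⟩ := h₂
      simp only [List.cons.injEq] at h
      obtain ⟨rfl, rfl⟩ := h
      exact ih h₁ h₂
    · obtain ⟨a, i₁, rfl, h₁⟩ := h₁
      obtain ⟨b, i₂, h, h₂⟩ := h₂
      simp only [List.cons.injEq] at h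
      obtain ⟨rfl, rfl⟩ := h
      exact ih h₁ h₂
    · obtain ⟨a, o₁, s₁, rfl, rfl, h₁⟩ := h₁
      obtain ⟨b, o₂, s₂, rfl, h, h₂⟩ := h₂
      simp only [List.cons.injEq] at h
      obtain ⟨rfl, rfl⟩ := h
      simpa using ih h₁ h₂
    · obtain ⟨a, o₁, s₁, rfl, rfl, h₁⟩ := h₁
      obtain ⟨b, o₂, s₂, rfl, h, h₂⟩ := h₂
      simp only [List.cons.injEq] at h
      obtain ⟨rfl, rfl⟩ := h
      simpa using ih h₁ h₂

theorem input_step {x : Step} (hx : x.isInput = true) (h : TwoStackRun (x :: w) i o s t s' t') :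
    ∃ a i₁ s₁ t₁, i = a :: i₁ ∧ (s₁ ++ t₁).Perm (a :: (s ++ t)) ∧
      TwoStackRun w i₁ o s₁ t₁ s' t' := by
  cases x <;> simp only [TwoStackRun, Step.isInput, Bool.false_eq_true] at h hx
  · obtain ⟨a, i, rfl, h⟩ := h
    exact ⟨a, i, _, _, rfl, by simp, h⟩
  · obtain ⟨a, i, rfl, h⟩ := h
    exact ⟨a, i, _, _, rfl, List.perm_middle, h⟩

theorem output_step {x : Step} (hx : x.isInput = false) (h : TwoStackRun (x :: w) i o s t s' t') :
    ∃ a o₁ s₁ t₁, o = a :: o₁ ∧ (s ++ t).Perm (a :: (s₁ ++ t₁)) ∧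
      TwoStackRun w i o₁ s₁ t₁ s' t' := by
  cases x <;> simp only [TwoStackRun, Step.isInput, Bool.true_eq_false] at h hx
  · obtain ⟨a, o, s₁, rfl, rfl, h⟩ := h
    exact ⟨a, o, _, _, rfl, by simp, h⟩
  · obtain ⟨a, o, s₁, rfl, rfl, h⟩ := h
    exact ⟨a, o, _, _, rfl, List.perm_middle, h⟩

theorem perm (h : TwoStackRun w i o s t s' t') : (o ++ (s' ++ t')).Perm (i ++ (s ++ t)) := by
  induction w generalizing i o s t with
  | nil => obtain ⟨rfl, rfl, rfl, rfl⟩ := h; simp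
  | cons x w ih =>
    cases hx : x.isInput
    · obtain ⟨a, o₁, s₁, t₁, rfl, hp, h⟩ := h.output_step hx
      refine ((ih h).cons a).trans ?_
      exact List.perm_middle.symm.trans (hp.symm.append_left i)
    · obtain ⟨a, i₁, s₁, t₁, rfl, hp, h⟩ := h.input_step hx
      exact (ih h).trans ((hp.append_left i₁).trans List.perm_middle)

theorem length_stacks (h : TwoStackRun w i o s t s' t') :
    (t'.length : ℤ) = t.length + (endpoint w).1 ∧
      (s'.length : ℤ) = s.length + (endpoint w).2 := by
  induction w generalizing i o s t with
  | nil => obtain ⟨rfl, rfl, rfl, rfl⟩ := h; simp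
  | cons x w ih =>
    cases x <;> simp only [TwoStackRun] at h
    · obtain ⟨a, i, rfl, h⟩ := h
      have := ih h
      simp only [endpoint_cons, Step.vec, Prod.fst_add, Prod.snd_add, List.length_cons] at this ⊢
      omega
    · obtain ⟨a, i, rfl, h⟩ := h
      have := ih h
      simp only [endpoint_cons, Step.vec, Prod.fst_add, Prod.snd_add, List.length_cons] at this ⊢
      omega
    · obtain ⟨a, o, s₁, rfl, rfl, h⟩ := h
      have := ih h
      simp only [endpoint_cons, Step.vec, Prod.fst_add, Prod.snd_add, List.length_cons] at this ⊢
      omega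
    · obtain ⟨a, o, s₁, rfl, rfl, h⟩ := h
      have := ih h
      simp only [endpoint_cons, Step.vec, Prod.fst_add, Prod.snd_add, List.length_cons] at this ⊢
      omega

/-- A walk can be performed if the stacks are never popped when they are empty. -/
theorem exists_of_prefix (hi : i.length = (w.map Step.isInput).count true)
    (h : ∀ u, u <+: w → 0 ≤ t.length + (endpoint u).1 ∧ 0 ≤ s.length + (endpoint u).2) :
    ∃ o s' t', TwoStackRun w i o s t s' t' := by
  induction w generalizing i s t with
  | nil => exact ⟨[], s, t, by simpa using hi, rfl, rfl, rfl⟩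
  | cons x w ih =>
    rw [forall_prefix_cons] at h
    obtain ⟨-, h⟩ := h
    have h0 := h [] List.nil_prefix
    cases x <;> simp only [List.map_cons, Step.isInput, List.count_cons_self, endpoint_cons,
      Step.vec, Prod.fst_add, Prod.snd_add, endpoint_nil, Prod.fst_zero, Prod.snd_zero] at hi h h0
    · obtain ⟨a, i, rfl⟩ := List.exists_cons_of_length_eq_add_one hi
      obtain ⟨o, s', t', h'⟩ := ih (s := a :: s) (t := t) (by simpa using hi) fun u hu => by
        have := h u hu; simp only [List.length_cons]; omega
      exact ⟨o, s', t', a, i, rfl, h'⟩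
    · obtain ⟨a, i, rfl⟩ := List.exists_cons_of_length_eq_add_one hi
      obtain ⟨o, s', t', h'⟩ := ih (s := s) (t := a :: t) (by simpa using hi) fun u hu => by
        have := h u hu; simp only [List.length_cons]; omega
      exact ⟨o, s', t', a, i, rfl, h'⟩
    · cases s with
      | nil => simp at h0
      | cons a s =>
        obtain ⟨o, s', t', h'⟩ := ih (s := s) (t := t) (by simpa using hi) fun u hu => by
          have := h u hu; simp only [List.length_cons] at this; omega
        exact ⟨a :: o, s', t', a, o, s, rfl, rfl, h'⟩
    · cases t with
      | nil => simp at h0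
      | cons a t =>
        obtain ⟨o, s', t', h'⟩ := ih (s := s) (t := t) (by simpa using hi) fun u hu => by
          have := h u hu; simp only [List.length_cons] at this; omega
        exact ⟨a :: o, s', t', a, o, t, rfl, rfl, h'⟩

theorem flip (h : TwoStackRun w i o s t s' t') :
    TwoStackRun (w.map Step.flip) i o t s t' s' := by
  induction w generalizing i o s t with
  | nil => obtain ⟨rfl, rfl, rfl, rfl⟩ := h; simp [TwoStackRun]
  | cons x w ih =>
    cases x <;> simp only [TwoStackRun, List.map_cons, Step.flip] at h ⊢
    · obtain ⟨a, i, rfl, h⟩ := h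
      exact ⟨_, _, rfl, ih h⟩
    · obtain ⟨a, i, rfl, h⟩ := h
      exact ⟨_, _, rfl, ih h⟩
    · obtain ⟨a, o, s₁, rfl, rfl, h⟩ := h
      exact ⟨_, _, _, rfl, rfl, ih h⟩
    · obtain ⟨a, o, s₁, rfl, rfl, h⟩ := h
      exact ⟨_, _, _, rfl, rfl, ih h⟩

theorem map (f : α → β) (h : TwoStackRun w i o s t s' t') :
    TwoStackRun w (i.map f) (o.map f) (s.map f) (t.map f) (s'.map f) (t'.map f) := by
  induction w generalizing i o s t with
  | nil => obtain ⟨rfl, rfl, rfl, rfl⟩ := h; simp [TwoStackRun]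
  | cons x w ih =>
    cases x <;> simp only [TwoStackRun] at h ⊢
    · obtain ⟨a, i, rfl, h⟩ := h
      exact ⟨_, _, rfl, ih h⟩
    · obtain ⟨a, i, rfl, h⟩ := h
      exact ⟨_, _, rfl, ih h⟩
    · obtain ⟨a, o, s₁, rfl, rfl, h⟩ := h
      exact ⟨_, _, _, rfl, rfl, ih h⟩
    · obtain ⟨a, o, s₁, rfl, rfl, h⟩ := h
      exact ⟨_, _, _, rfl, rfl, ih h⟩

theorem reflTransGen {α : Type} {i o s t s' t' : List α} (h : TwoStackRun w i o s t s' t')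
    (o₀ : List α) :
    Relation.ReflTransGen TwoStackStep ⟨i, s, t, o₀⟩ ⟨[], s', t', o₀ ++ o⟩ := by
  induction w generalizing i o s t o₀ with
  | nil => obtain ⟨rfl, rfl, rfl, rfl⟩ := h; simp [Relation.ReflTransGen.refl]
  | cons x w ih =>
    cases x <;> simp only [TwoStackRun] at h
    · obtain ⟨a, i, rfl, h⟩ := h
      exact .head (.I₁ _ _ _ _ _) (ih h o₀)
    · obtain ⟨a, i, rfl, h⟩ := h
      exact .head (.I₂ _ _ _ _ _) (ih h o₀)
    · obtain ⟨a, o, s₁, rfl, rfl, h⟩ := h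
      exact .head (.O₁ _ _ _ _ _) (by simpa using ih h (o₀ ++ [a]))
    · obtain ⟨a, o, s₁, rfl, rfl, h⟩ := h
      exact .head (.O₂ _ _ _ _ _) (by simpa using ih h (o₀ ++ [a]))

/-- Reflecting a section that never touches the elements `s`, `t` below the top parts `X`, `Y`, and
in the end has removed `X` and `Y`, does not change what the machine does. -/
theorem flip_section {X Y : List α} (hv : Returns v Y.length X.length)
    (h : TwoStackRun (v ++ z) i o (X ++ s) (Y ++ t) s' t') :
    TwoStackRun (v.map Step.flip ++ z) i o (Y ++ s) (X ++ t) s' t' := by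
  induction v generalizing i o X Y with
  | nil =>
    obtain ⟨h1, h2⟩ := hv
    rw [List.length_eq_zero_iff] at h1 h2
    subst h1 h2
    exact h
  | cons x v ih =>
    cases x <;>
      simp only [TwoStackRun, List.cons_append, Returns, List.map_cons, Step.flip] at h hv ⊢
    · obtain ⟨a, i, rfl, h⟩ := h
      exact ⟨a, i, rfl, ih (X := a :: X) hv h⟩
    · obtain ⟨a, i, rfl, h⟩ := h
      exact ⟨a, i, rfl, ih (Y := a :: Y) hv h⟩
    · obtain ⟨a, o, d, rfl, h1, h⟩ := h
      obtain ⟨y', hy, hv⟩ := hv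
      obtain ⟨b, X, rfl⟩ := List.exists_cons_of_length_eq_add_one hy
      simp only [List.cons_append, List.cons.injEq] at h1
      obtain ⟨rfl, rfl⟩ := h1
      refine ⟨_, _, X ++ t, rfl, rfl, ih ?_ h⟩
      convert hv using 1; simpa using hy
    · obtain ⟨a, o, d, rfl, h1, h⟩ := h
      obtain ⟨y', hy, hv⟩ := hv
      obtain ⟨b, Y, rfl⟩ := List.exists_cons_of_length_eq_add_one hy
      simp only [List.cons_append, List.cons.injEq] at h1
      obtain ⟨rfl, rfl⟩ := h1
      refine ⟨_, _, Y ++ s, rfl, rfl, ih ?_ h⟩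
      convert hv using 1; simpa using hy

theorem length_eq (h : TwoStackRun w i o s t s' t') : w.length = i.length + o.length := by
  induction w generalizing i o s t with
  | nil => obtain ⟨rfl, rfl, -⟩ := h; rfl
  | cons x w ih =>
    cases hx : x.isInput
    · obtain ⟨a, o₁, s₁, t₁, rfl, hp, h⟩ := h.output_step hx
      have := ih h; simp; omega
    · obtain ⟨a, i₁, s₁, t₁, rfl, hp, h⟩ := h.input_step hx
      have := ih h; simp; omega

/-- Changing the tail of a run into another possible tail. -/
theorem replace_tail {z' : List Step} (hz : ∀ i o s t : List α, TwoStackRun z i o s t s' t' →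
    TwoStackRun z' i o s t s' t') (h : TwoStackRun (u ++ z) i o s t s' t') :
    TwoStackRun (u ++ z') i o s t s' t' := by
  induction u generalizing i o s t with
  | nil => exact hz i o s t h
  | cons x u ih =>
    cases x <;> simp only [TwoStackRun, List.cons_append] at h ⊢
    · obtain ⟨a, i, rfl, h⟩ := h
      exact ⟨_, _, rfl, ih h⟩
    · obtain ⟨a, i, rfl, h⟩ := h
      exact ⟨_, _, rfl, ih h⟩
    · obtain ⟨a, o, s₁, rfl, rfl, h⟩ := h
      exact ⟨_, _, _, rfl, rfl, ih h⟩
    · obtain ⟨a, o, s₁, rfl, rfl, h⟩ := h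
      exact ⟨_, _, _, rfl, rfl, ih h⟩

/-- Each walk can be made standard without changing its input and output pattern and its effect. -/
theorem exists_isStandard (h : TwoStackRun w i o s t s' t') :
    ∃ w', IsStandard w' ∧ w'.map Step.isInput = w.map Step.isInput ∧
      TwoStackRun w' i o s t s' t' := by
  have hfin : {w' | w'.map Step.isInput = w.map Step.isInput ∧
      TwoStackRun w' i o s t s' t'}.Finite :=
    (List.finite_length_eq Step (i.length + o.length)).subset fun w hw => length_eq hw.2
  obtain ⟨w', hw', hmin⟩ :=
    Set.exists_min_image _ (fun w : List Step => w.map Step.code) hfin ⟨w, rfl, h⟩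
  refine ⟨w', isStandard_of_forall fun u v z e hv => ?_, hw'.1, hw'.2⟩
  subst e
  refine absurd (hmin (u ++ (.N :: v.map Step.flip ++ z)) ⟨?_, ?_⟩) (not_le.2 ?_)
  · rw [← hw'.1]
    simpa [Step.isInput] using map_isInput_flip v
  · refine hw'.2.replace_tail fun i o s t h => ?_
    simpa [Step.flip] using
      flip_section (v := .E :: v) (X := []) (Y := []) (s := s) (t := t) hv (by simpa using h)
  · exact map_code_append_lt u (by simp [List.cons_lt_cons_iff, Step.code])

/-! ### Eager runs -/

theorem head_notMem_of_isEager {x : Step} (hx : x.isInput = true) (he : IsEager (x :: w))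
    (h : TwoStackRun (x :: w) i o s t s' t') (hd : (i ++ (s ++ t)).Nodup) {b : α}
    (hb : o.head? = some b) : b ∉ s ++ t := by
  induction w generalizing x i s t with
  | nil =>
    cases x <;> simp only [TwoStackRun, Step.isInput, Bool.false_eq_true] at h hx
    all_goals obtain ⟨a, i, -, -, rfl, -⟩ := h; simp at hb
  | cons y w ih =>
    cases hy : y.isInput
    · have hh := (isEager_cons _ _).1 he
      cases x <;> cases y <;> simp [Step.isInput] at hx hy hh
      · simp only [TwoStackRun] at h
        obtain ⟨a, i, rfl, b, o, s, rfl, h, -⟩ := h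
        simp only [List.cons.injEq, List.head?_cons, Option.some.injEq] at h hb
        obtain ⟨rfl, rfl⟩ := h
        subst hb
        grind
      · simp only [TwoStackRun] at h
        obtain ⟨a, i, rfl, b, o, s, rfl, h, -⟩ := h
        simp only [List.cons.injEq, List.head?_cons, Option.some.injEq] at h hb
        obtain ⟨rfl, rfl⟩ := h
        subst hb
        grind
    · obtain ⟨a, i, s₁, t₁, rfl, hp, h⟩ := h.input_step hx
      have hd' : (i ++ (s₁ ++ t₁)).Nodup :=
        ((hp.append_left i).trans List.perm_middle).nodup_iff.2 hd
      have := ih hy ((isEager_cons _ _).1 he).2 h hd'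
      rw [hp.mem_iff] at this
      exact fun h => this (List.mem_cons_of_mem _ h)

/-- Eager walks with the same input and output have the same pattern of input and output operations:
where the patterns first differed, one walk would output an element of the machine and the other one
would first insert further elements, but then its next output would be an inserted element. -/
theorem map_isInput_eq_of_isEager {s₁ t₁ s₁' t₁' s₂ t₂ s₂' t₂' : List α}
    (h₁ : TwoStackRun w₁ i o s₁ t₁ s₁' t₁') (h₂ : TwoStackRun w₂ i o s₂ t₂ s₂' t₂')
    (hp : (s₁ ++ t₁).Perm (s₂ ++ t₂)) (hd : (i ++ (s₁ ++ t₁)).Nodup)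
    (he₁ : IsEager w₁) (he₂ : IsEager w₂) : w₁.map Step.isInput = w₂.map Step.isInput := by
  induction w₁ generalizing w₂ i o s₁ t₁ s₂ t₂ with
  | nil =>
    obtain ⟨rfl, rfl, -⟩ := h₁
    have := h₂.length_eq
    simp_all
  | cons x w₁ ih =>
    cases w₂ with
    | nil =>
      obtain ⟨rfl, rfl, -⟩ := h₂
      have := h₁.length_eq
      simp_all
    | cons y w₂ =>
      have hd₂ : (i ++ (s₂ ++ t₂)).Nodup := (hp.append_left i).nodup_iff.1 hd
      have he₁' := ((isEager_cons _ _).1 he₁).2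
      have he₂' := ((isEager_cons _ _).1 he₂).2
      cases hx : x.isInput <;> cases hy : y.isInput
      · obtain ⟨a, o, s₃, t₃, rfl, hp₁, h₁⟩ := h₁.output_step hx
        obtain ⟨b, o, s₄, t₄, h, hp₂, h₂⟩ := h₂.output_step hy
        simp only [List.cons.injEq] at h
        obtain ⟨rfl, rfl⟩ := h
        simp only [List.map_cons, hx, hy, List.cons.injEq, true_and]
        refine ih h₁ h₂ ?_ ?_ he₁' he₂'
        · exact ((hp₁.symm.trans hp).trans hp₂).cons_inv
        · exact List.Nodup.of_cons
            (((hp₁.append_left i).trans List.perm_middle).nodup_iff.1 hd)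
      · obtain ⟨a, o, s₃, t₃, rfl, hp₁, h₁⟩ := h₁.output_step hx
        refine absurd ?_ (head_notMem_of_isEager hy he₂ h₂ hd₂ rfl)
        rw [← hp.mem_iff, hp₁.mem_iff]
        simp
      · obtain ⟨a, o, s₃, t₃, rfl, hp₁, h₂⟩ := h₂.output_step hy
        refine absurd ?_ (head_notMem_of_isEager hx he₁ h₁ hd rfl)
        rw [hp.mem_iff, hp₁.mem_iff]
        simp
      · obtain ⟨a, i, s₃, t₃, rfl, hp₁, h₁⟩ := h₁.input_step hx
        obtain ⟨b, i, s₄, t₄, h, hp₂, h₂⟩ := h₂.input_step hy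
        simp only [List.cons.injEq] at h
        obtain ⟨rfl, rfl⟩ := h
        simp only [List.map_cons, hx, hy, List.cons.injEq, true_and]
        refine ih h₁ h₂ ?_ ?_ he₁' he₂'
        · exact (hp₁.trans (hp.cons _)).trans hp₂.symm
        · exact ((hp₁.append_left i).trans List.perm_middle).nodup_iff.2 hd

/-- Eagerness depends only on the pattern of input and output operations and on the output. -/
theorem isEager_of_map_isInput_eq {s₁ t₁ s₁' t₁' s₂ t₂ s₂' t₂' : List α}
    (h₁ : TwoStackRun w₁ i o s₁ t₁ s₁' t₁') (h₂ : TwoStackRun w₂ i o s₂ t₂ s₂' t₂')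
    (hp : (s₁ ++ t₁).Perm (s₂ ++ t₂)) (hd : (i ++ (s₁ ++ t₁)).Nodup)
    (hio : w₁.map Step.isInput = w₂.map Step.isInput) (he : IsEager w₁) : IsEager w₂ := by
  induction w₁ generalizing w₂ i o s₁ t₁ s₂ t₂ with
  | nil =>
    obtain rfl : w₂ = [] := by simpa using hio
    exact isEager_nil
  | cons x w₁ ih =>
    cases w₂ with
    | nil => exact isEager_nil
    | cons y w₂ =>
      simp only [List.map_cons, List.cons.injEq] at hio
      obtain ⟨hxy, hio⟩ := hio
      have he' := ((isEager_cons _ _).1 he).2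
      rw [isEager_cons]
      refine ⟨⟨?_, ?_⟩, ?_⟩
      · rintro ⟨rfl, hw⟩
        cases w₂ with
        | nil => simp at hw
        | cons z w₂ =>
          simp only [List.head?_cons, Option.some.injEq] at hw
          subst hw
          simp only [TwoStackRun] at h₂
          obtain ⟨a, i, rfl, b, o, s, rfl, rfl, -⟩ := h₂
          refine head_notMem_of_isEager hxy he h₁ hd rfl ?_
          rw [hp.mem_iff]
          simp
      · rintro ⟨rfl, hw⟩
        cases w₂ with
        | nil => simp at hw
        | cons z w₂ =>
          simp only [List.head?_cons, Option.some.injEq] at hw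
          subst hw
          simp only [TwoStackRun] at h₂
          obtain ⟨a, i, rfl, b, o, s, rfl, rfl, -⟩ := h₂
          refine head_notMem_of_isEager hxy he h₁ hd rfl ?_
          rw [hp.mem_iff]
          simp
      · cases hx : x.isInput
        · obtain ⟨a, o, s₃, t₃, rfl, hp₁, h₁⟩ := h₁.output_step hx
          obtain ⟨b, o, s₄, t₄, h, hp₂, h₂⟩ := h₂.output_step (hxy ▸ hx)
          simp only [List.cons.injEq] at h
          obtain ⟨rfl, rfl⟩ := h
          refine ih h₁ h₂ ?_ ?_ hio he'
          · exact ((hp₁.symm.trans hp).trans hp₂).cons_inv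
          · exact List.Nodup.of_cons
              (((hp₁.append_left i).trans List.perm_middle).nodup_iff.1 hd)
        · obtain ⟨a, i, s₃, t₃, rfl, hp₁, h₁⟩ := h₁.input_step hx
          obtain ⟨b, i, s₄, t₄, h, hp₂, h₂⟩ := h₂.input_step (hxy ▸ hx)
          simp only [List.cons.injEq] at h
          obtain ⟨rfl, rfl⟩ := h
          refine ih h₁ h₂ ?_ ?_ hio he'
          · exact (hp₁.trans (hp.cons _)).trans hp₂.symm
          · exact ((hp₁.append_left i).trans List.perm_middle).nodup_iff.2 hd

end TwoStackRun

/-! ### Uniqueness of standard walks -/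

/-- The two stacks `X` and `Y` do not have a common bottom element; this includes the case that one of
them is empty. -/
def BottomsDiffer {α : Type*} (X Y : List α) : Prop :=
  ∀ b, X.getLast? = some b → Y.getLast? ≠ some b

namespace BottomsDiffer

variable {α : Type*} {X Y : List α} {a : α}

theorem symm (h : BottomsDiffer X Y) : BottomsDiffer Y X := fun b h1 h2 => h b h2 h1

theorem eq_nil (h : BottomsDiffer X X) : X = [] := by
  rw [← List.getLast?_eq_none_iff]
  cases e : X.getLast? with
  | none => rfl
  | some b => exact absurd e (h b e)

theorem cons_left (h : BottomsDiffer X Y) (ha : a ∉ Y) : BottomsDiffer (a :: X) Y := by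
  intro b h1 h2
  rw [List.getLast?_cons] at h1
  cases e : X.getLast? with
  | none =>
    simp only [e, Option.getD_none, Option.some.injEq] at h1
    subst h1
    exact ha (List.mem_of_getLast? h2)
  | some c =>
    simp only [e, Option.getD_some, Option.some.injEq] at h1
    subst h1
    exact h c e h2

theorem cons_right (h : BottomsDiffer X Y) (ha : a ∉ X) : BottomsDiffer X (a :: Y) :=
  (h.symm.cons_left ha).symm

theorem cons_cons (h : BottomsDiffer X Y) (hX : a ∉ X) (hY : a ∉ Y) (hne : ¬ (X = [] ∧ Y = [])) :
    BottomsDiffer (a :: X) (a :: Y) := by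
  intro b h1 h2
  rw [List.getLast?_cons] at h1 h2
  cases e : X.getLast? with
  | none =>
    simp only [e, Option.getD_none, Option.some.injEq] at h1
    subst h1
    rw [List.getLast?_eq_none_iff] at e
    cases e' : Y.getLast? with
    | none =>
      rw [List.getLast?_eq_none_iff] at e'
      exact hne ⟨e, e'⟩
    | some c =>
      simp only [e', Option.getD_some, Option.some.injEq] at h2
      subst h2
      exact hY (List.mem_of_getLast? e')
  | some c =>
    simp only [e, Option.getD_some, Option.some.injEq] at h1
    subst h1
    cases e' : Y.getLast? with
    | none =>
      simp only [e', Option.getD_none, Option.some.injEq] at h2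
      subst h2
      exact hX (List.mem_of_getLast? e)
    | some d =>
      simp only [e', Option.getD_some, Option.some.injEq] at h2
      subst h2
      exact h _ e e'

theorem of_cons_left (h : BottomsDiffer (a :: X) Y) : BottomsDiffer X Y := by
  intro b h1 h2
  refine h b ?_ h2
  rw [List.getLast?_cons, h1]
  rfl

theorem of_cons_right (h : BottomsDiffer X (a :: Y)) : BottomsDiffer X Y :=
  h.symm.of_cons_left.symm

end BottomsDiffer

namespace TwoStackRun

variable {α : Type*} [LinearOrder α] {w₁ w₂ : List Step} {i o s t s' t' : List α}

/-- Two runs with the same input, output and final stacks, that started from the same stacks `s`, `t`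
but have since distributed the inserted elements differently among the stacks, have to clear all the
inserted elements before they touch `s` and `t`. Here `X`, `Y` and `X'`, `Y'` are the inserted elements
present in the two machines. Input elements increase, so stacks with the same elements are equal; the
invariant is that the bottoms of `X` and `X'` differ, and those of `Y` and `Y'`. -/
theorem exists_returns {X Y X' Y' : List α} (hio : w₁.map Step.isInput = w₂.map Step.isInput)
    (h₁ : TwoStackRun w₁ i o (X ++ s) (Y ++ t) s' t')
    (h₂ : TwoStackRun w₂ i o (X' ++ s) (Y' ++ t) s' t')
    (hst : ∀ a ∈ s, a ∉ t) (hi : ∀ a ∈ i, a ∉ s ∧ a ∉ t)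
    (hnX : ∀ a ∈ X, a ∉ s ∧ a ∉ t) (hnY : ∀ a ∈ Y, a ∉ s ∧ a ∉ t)
    (hp : (X ++ Y).Perm (X' ++ Y'))
    (hX : (i.reverse ++ X).Pairwise (· > ·)) (hY : (i.reverse ++ Y).Pairwise (· > ·))
    (hX' : (i.reverse ++ X').Pairwise (· > ·)) (hY' : (i.reverse ++ Y').Pairwise (· > ·))
    (hbX : BottomsDiffer X X') (hbY : BottomsDiffer Y Y') :
    ∃ p, p <+: w₂ ∧ Returns p Y'.length X'.length := by
  induction w₁ generalizing w₂ i o X Y X' Y' with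
  | nil =>
    obtain rfl : w₂ = [] := by simpa using hio
    obtain ⟨rfl, rfl, rfl, rfl⟩ := h₁
    obtain ⟨-, -, h1, h2⟩ := h₂
    obtain rfl := List.append_cancel_right h1
    obtain rfl := List.append_cancel_right h2
    rw [hbX.eq_nil, hbY.eq_nil]
    exact ⟨[], List.nil_prefix, rfl, rfl⟩
  | cons x w₁ ih =>
    cases w₂ with
    | nil => simp at hio
    | cons y w₂ =>
    simp only [List.map_cons, List.cons.injEq] at hio
    obtain ⟨hxy, hio⟩ := hio
    by_cases hnil : X' = [] ∧ Y' = []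
    · obtain ⟨rfl, rfl⟩ := hnil
      exact ⟨[], List.nil_prefix, rfl, rfl⟩
    -- If the new parts of one stack were both empty, those of the other one would be equal.
    have hneX : ¬ (X = [] ∧ X' = []) := by
      rintro ⟨rfl, rfl⟩
      have e : Y = Y' := hp.eq_of_pairwise' ((List.pairwise_append.1 hY).2.1)
        ((List.pairwise_append.1 hY').2.1)
      subst e
      exact hnil ⟨rfl, hbY.eq_nil⟩
    have hneY : ¬ (Y = [] ∧ Y' = []) := by
      rintro ⟨rfl, rfl⟩
      have e : X = X' := by
        simp only [List.append_nil] at hp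
        exact hp.eq_of_pairwise' ((List.pairwise_append.1 hX).2.1)
          ((List.pairwise_append.1 hX').2.1)
      subst e
      exact hnil ⟨hbX.eq_nil, rfl⟩
    have hold₁ (a : α) (ha : a ∈ X ∨ a ∈ Y) : a ∉ s ∧ a ∉ t :=
      ha.elim (hnX a) (hnY a)
    have hold₂ (a : α) (ha : a ∈ X' ∨ a ∈ Y') : a ∉ s ∧ a ∉ t :=
      hold₁ a (List.mem_append.1 (hp.mem_iff.2 (List.mem_append.2 ha)))
    have input {a : α} {i : List α} {Z : List α}
        (h : ((a :: i).reverse ++ Z).Pairwise (· > ·)) :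
        (i.reverse ++ a :: Z).Pairwise (· > ·) ∧ (i.reverse ++ Z).Pairwise (· > ·) ∧ a ∉ Z := by
      rw [List.reverse_cons, List.append_assoc] at h
      refine ⟨h, h.sublist (List.Sublist.append_left (List.sublist_cons_self a Z) _), fun hm => ?_⟩
      exact lt_irrefl a ((List.pairwise_cons.1 (List.pairwise_append.1 h).2.1).1 a hm)
    have output {a : α} {Z : List α} (h : (i.reverse ++ a :: Z).Pairwise (· > ·)) :
        (i.reverse ++ Z).Pairwise (· > ·) :=
      h.sublist (List.Sublist.append_left (List.sublist_cons_self a Z) _)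
    cases x <;> cases y <;> simp only [Step.isInput, reduceCtorEq] at hxy <;>
      simp only [TwoStackRun] at h₁ h₂
    · obtain ⟨a, i, rfl, h₁⟩ := h₁
      obtain ⟨b, j, e, h₂⟩ := h₂
      simp only [List.cons.injEq] at e
      obtain ⟨rfl, rfl⟩ := e
      obtain ⟨p, hp, hr⟩ := ih (X := a :: X) (X' := a :: X') hio h₁ h₂
        (List.forall_mem_cons.1 hi).2 (List.forall_mem_cons.2 ⟨hi a List.mem_cons_self, hnX⟩) hnY
        (by simpa using hp)
        (input hX).1 (input hY).2.1 (input hX').1 (input hY').2.1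
        (hbX.cons_cons (input hX).2.2 (input hX').2.2 hneX) hbY
      exact ⟨.N :: p, List.cons_prefix_cons.2 ⟨rfl, hp⟩, hr⟩
    · obtain ⟨a, i, rfl, h₁⟩ := h₁
      obtain ⟨b, j, e, h₂⟩ := h₂
      simp only [List.cons.injEq] at e
      obtain ⟨rfl, rfl⟩ := e
      obtain ⟨p, hp, hr⟩ := ih (X := a :: X) (Y' := a :: Y') hio h₁ h₂
        (List.forall_mem_cons.1 hi).2 (List.forall_mem_cons.2 ⟨hi a List.mem_cons_self, hnX⟩) hnY
        ((hp.cons a).trans List.perm_middle.symm)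
        (input hX).1 (input hY).2.1 (input hX').2.1 (input hY').1
        (hbX.cons_left (input hX').2.2) (hbY.cons_right (input hY).2.2)
      exact ⟨.E :: p, List.cons_prefix_cons.2 ⟨rfl, hp⟩, hr⟩
    · obtain ⟨a, i, rfl, h₁⟩ := h₁
      obtain ⟨b, j, e, h₂⟩ := h₂
      simp only [List.cons.injEq] at e
      obtain ⟨rfl, rfl⟩ := e
      obtain ⟨p, hp, hr⟩ := ih (Y := a :: Y) (X' := a :: X') hio h₁ h₂
        (List.forall_mem_cons.1 hi).2 hnX
        (List.forall_mem_cons.2 ⟨hi a List.mem_cons_self, hnY⟩)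
        (List.perm_middle.trans (hp.cons a))
        (input hX).2.1 (input hY).1 (input hX').1 (input hY').2.1
        (hbX.cons_right (input hX).2.2) (hbY.cons_left (input hY').2.2)
      exact ⟨.N :: p, List.cons_prefix_cons.2 ⟨rfl, hp⟩, hr⟩
    · obtain ⟨a, i, rfl, h₁⟩ := h₁
      obtain ⟨b, j, e, h₂⟩ := h₂
      simp only [List.cons.injEq] at e
      obtain ⟨rfl, rfl⟩ := e
      obtain ⟨p, hp, hr⟩ := ih (Y := a :: Y) (Y' := a :: Y') hio h₁ h₂
        (List.forall_mem_cons.1 hi).2 hnX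
        (List.forall_mem_cons.2 ⟨hi a List.mem_cons_self, hnY⟩)
        (List.perm_middle.trans ((hp.cons a).trans List.perm_middle.symm))
        (input hX).2.1 (input hY).1 (input hX').2.1 (input hY').1
        hbX (hbY.cons_cons (input hY).2.2 (input hY').2.2 hneY)
      exact ⟨.E :: p, List.cons_prefix_cons.2 ⟨rfl, hp⟩, hr⟩
    · obtain ⟨a, o, d₁, rfl, e₁, h₁⟩ := h₁
      obtain ⟨b, o', d₂, e, e₂, h₂⟩ := h₂
      simp only [List.cons.injEq] at e
      obtain ⟨rfl, rfl⟩ := e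
      rcases List.append_eq_cons_iff.1 e₁ with ⟨rfl, f₁⟩ | ⟨X, rfl, rfl⟩ <;>
        rcases List.append_eq_cons_iff.1 e₂ with ⟨rfl, f₂⟩ | ⟨X', rfl, rfl⟩
      · exact absurd ⟨rfl, rfl⟩ hneX
      · exact ((hold₂ a (.inl List.mem_cons_self)).1 (by simp [f₁])).elim
      · exact ((hold₁ a (.inl List.mem_cons_self)).1 (by simp [f₂])).elim
      · obtain ⟨p, hp, hr⟩ := ih (X := X) (X' := X') hio h₁ h₂
          hi (List.forall_mem_cons.1 hnX).2 hnY
          (hp.cons_inv)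
          (output hX) hY (output hX') hY' hbX.of_cons_left.of_cons_right hbY
        exact ⟨.S :: p, List.cons_prefix_cons.2 ⟨rfl, hp⟩, _, rfl, hr⟩
    · obtain ⟨a, o, d₁, rfl, e₁, h₁⟩ := h₁
      obtain ⟨b, o', d₂, e, e₂, h₂⟩ := h₂
      simp only [List.cons.injEq] at e
      obtain ⟨rfl, rfl⟩ := e
      rcases List.append_eq_cons_iff.1 e₁ with ⟨rfl, f₁⟩ | ⟨X, rfl, rfl⟩ <;>
        rcases List.append_eq_cons_iff.1 e₂ with ⟨rfl, f₂⟩ | ⟨Y', rfl, rfl⟩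
      · exact ((hst a (by simp [f₁])) (by simp [f₂])).elim
      · exact ((hold₂ a (.inr List.mem_cons_self)).1 (by simp [f₁])).elim
      · exact ((hold₁ a (.inl List.mem_cons_self)).2 (by simp [f₂])).elim
      · obtain ⟨p, hp, hr⟩ := ih (X := X) (Y' := Y') hio h₁ h₂
          hi (List.forall_mem_cons.1 hnX).2 hnY
          (hp.trans List.perm_middle).cons_inv
          (output hX) hY hX' (output hY') hbX.of_cons_left hbY.of_cons_right
        exact ⟨.W :: p, List.cons_prefix_cons.2 ⟨rfl, hp⟩, _, rfl, hr⟩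
    · obtain ⟨a, o, d₁, rfl, e₁, h₁⟩ := h₁
      obtain ⟨b, o', d₂, e, e₂, h₂⟩ := h₂
      simp only [List.cons.injEq] at e
      obtain ⟨rfl, rfl⟩ := e
      rcases List.append_eq_cons_iff.1 e₁ with ⟨rfl, f₁⟩ | ⟨Y, rfl, rfl⟩ <;>
        rcases List.append_eq_cons_iff.1 e₂ with ⟨rfl, f₂⟩ | ⟨X', rfl, rfl⟩
      · exact ((hst a (by simp [f₂])) (by simp [f₁])).elim
      · exact ((hold₂ a (.inl List.mem_cons_self)).2 (by simp [f₁])).elim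
      · exact ((hold₁ a (.inr List.mem_cons_self)).1 (by simp [f₂])).elim
      · obtain ⟨p, hp, hr⟩ := ih (Y := Y) (X' := X') hio h₁ h₂
          hi hnX (List.forall_mem_cons.1 hnY).2
          (List.perm_middle.symm.trans hp).cons_inv
          hX (output hY) (output hX') hY' hbX.of_cons_right hbY.of_cons_left
        exact ⟨.S :: p, List.cons_prefix_cons.2 ⟨rfl, hp⟩, _, rfl, hr⟩
    · obtain ⟨a, o, d₁, rfl, e₁, h₁⟩ := h₁
      obtain ⟨b, o', d₂, e, e₂, h₂⟩ := h₂
      simp only [List.cons.injEq] at e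
      obtain ⟨rfl, rfl⟩ := e
      rcases List.append_eq_cons_iff.1 e₁ with ⟨rfl, f₁⟩ | ⟨Y, rfl, rfl⟩ <;>
        rcases List.append_eq_cons_iff.1 e₂ with ⟨rfl, f₂⟩ | ⟨Y', rfl, rfl⟩
      · exact absurd ⟨rfl, rfl⟩ hneY
      · exact ((hold₂ a (.inr List.mem_cons_self)).2 (by simp [f₁])).elim
      · exact ((hold₁ a (.inr List.mem_cons_self)).2 (by simp [f₂])).elim
      · obtain ⟨p, hp, hr⟩ := ih (Y := Y) (Y' := Y') hio h₁ h₂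
          hi hnX (List.forall_mem_cons.1 hnY).2
          (List.perm_middle.symm.trans (hp.trans List.perm_middle)).cons_inv
          hX (output hY) hX' (output hY') hbX hbY.of_cons_left.of_cons_right
        exact ⟨.W :: p, List.cons_prefix_cons.2 ⟨rfl, hp⟩, _, rfl, hr⟩

/-- A standard walk is determined by its pattern of input and output operations and by its effect:
where two such walks first differed, the one that continues with `E` would have a quarter-plane
subloop. -/
theorem eq_of_isStandard (hio : w₁.map Step.isInput = w₂.map Step.isInput)
    (h₁ : TwoStackRun w₁ i o s t s' t') (h₂ : TwoStackRun w₂ i o s t s' t')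
    (hs₁ : IsStandard w₁) (hs₂ : IsStandard w₂) (hi : i.Pairwise (· < ·))
    (hd : (i ++ (s ++ t)).Nodup) : w₁ = w₂ := by
  induction w₁ generalizing w₂ i o s t with
  | nil => exact (by simpa using hio : w₂ = []).symm
  | cons x w₁ ih =>
    cases w₂ with
    | nil => simp at hio
    | cons y w₂ =>
    simp only [List.map_cons, List.cons.injEq] at hio
    obtain ⟨hxy, hio⟩ := hio
    rw [isStandard_cons] at hs₁ hs₂
    have hst : ∀ a ∈ s, a ∉ t := by grind
    have hi' : i.reverse.Pairwise (· > ·) := List.pairwise_reverse.2 hi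
    cases x <;> cases y <;> simp only [Step.isInput, reduceCtorEq] at hxy <;>
      simp only [TwoStackRun] at h₁ h₂
    · obtain ⟨a, i, rfl, h₁⟩ := h₁
      obtain ⟨b, j, e, h₂⟩ := h₂
      simp only [List.cons.injEq] at e
      obtain ⟨rfl, rfl⟩ := e
      rw [ih hio h₁ h₂ hs₁.2 hs₂.2 (List.pairwise_cons.1 hi).2
        ((List.perm_middle (l₁ := i) (a := a) (l₂ := s ++ t)).nodup_iff.2 hd)]
    · exfalso
      obtain ⟨a, i, rfl, h₁⟩ := h₁
      obtain ⟨b, j, e, h₂⟩ := h₂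
      simp only [List.cons.injEq] at e
      obtain ⟨rfl, rfl⟩ := e
      rw [List.reverse_cons] at hi'
      obtain ⟨p, hp, hr⟩ := exists_returns (X := [a]) (Y := []) (X' := []) (Y' := [a]) hio h₁ h₂
        hst (by grind) (by grind) (by simp) (by simp) hi' (by simpa using (List.pairwise_append.1 hi').1)
        (by simpa using (List.pairwise_append.1 hi').1) hi'
        (by simp [BottomsDiffer]) (by simp [BottomsDiffer])
      exact hs₂.1 rfl p hp hr
    · exfalso
      obtain ⟨a, i, rfl, h₁⟩ := h₁
      obtain ⟨b, j, e, h₂⟩ := h₂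
      simp only [List.cons.injEq] at e
      obtain ⟨rfl, rfl⟩ := e
      rw [List.reverse_cons] at hi'
      obtain ⟨p, hp, hr⟩ := exists_returns (X := [a]) (Y := []) (X' := []) (Y' := [a]) hio.symm
        h₂ h₁ hst (by grind) (by grind) (by simp) (by simp) hi' (by simpa using (List.pairwise_append.1 hi').1)
        (by simpa using (List.pairwise_append.1 hi').1) hi'
        (by simp [BottomsDiffer]) (by simp [BottomsDiffer])
      exact hs₁.1 rfl p hp hr
    · obtain ⟨a, i, rfl, h₁⟩ := h₁
      obtain ⟨b, j, e, h₂⟩ := h₂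
      simp only [List.cons.injEq] at e
      obtain ⟨rfl, rfl⟩ := e
      rw [ih hio h₁ h₂ hs₁.2 hs₂.2 (List.pairwise_cons.1 hi).2 (by
        refine (List.Perm.nodup_iff ?_).2 hd
        exact (List.perm_middle.append_left i).trans List.perm_middle)]
    · obtain ⟨a, o, s, rfl, rfl, h₁⟩ := h₁
      obtain ⟨b, o', s', e, e', h₂⟩ := h₂
      simp only [List.cons.injEq] at e e'
      obtain ⟨rfl, rfl⟩ := e
      obtain ⟨-, rfl⟩ := e'
      rw [ih hio h₁ h₂ hs₁.2 hs₂.2 hi (hd.sublist ?_)]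
      simp
    · obtain ⟨a, o, s, rfl, rfl, -⟩ := h₁
      obtain ⟨b, o', t, e, rfl, -⟩ := h₂
      simp only [List.cons.injEq] at e
      exact ((hst a (by simp)) (by simp [e.1])).elim
    · obtain ⟨a, o, t, rfl, rfl, -⟩ := h₁
      obtain ⟨b, o', s, e, rfl, -⟩ := h₂
      simp only [List.cons.injEq] at e
      exact ((hst a (by simp [e.1])) (by simp)).elim
    · obtain ⟨a, o, s, rfl, rfl, h₁⟩ := h₁
      obtain ⟨b, o', s', e, e', h₂⟩ := h₂
      simp only [List.cons.injEq] at e e'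
      obtain ⟨rfl, rfl⟩ := e
      obtain ⟨-, rfl⟩ := e'
      rw [ih hio h₁ h₂ hs₁.2 hs₂.2 hi (hd.sublist ?_)]
      simp

end TwoStackRun

/-! ### Sortable permutations from standard eager quarter-plane excursions -/

theorem Returns.balanced {w : List Step} {x y : ℕ} (h : Returns w x y) :
    Balanced (w.map Step.isInput) (x + y) := by
  obtain ⟨h1, h2⟩ := (returns_iff w x y).1 h
  refine (balanced_iff w (x + y)).2 ⟨by push_cast; omega, fun u hu => ?_⟩
  have := h2 u hu
  push_cast; omega

theorem exists_perm_of_perm_finRange {n : ℕ} {o : List (Fin n)} (h : o.Perm (List.finRange n)) :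
    ∃ π : Equiv.Perm (Fin n), o = List.ofFn π := by
  have hl : o.length = n := by simpa using h.length_eq
  have hd : o.Nodup := h.nodup_iff.2 (List.nodup_finRange n)
  have hinj : Function.Injective fun k : Fin n => o[(k : ℕ)]'(by omega) := fun a b hab =>
    Fin.ext ((hd.getElem_inj_iff).1 hab)
  refine ⟨Equiv.ofBijective _ (Finite.injective_iff_bijective.1 hinj), ?_⟩
  exact List.ext_getElem (by simp [hl]) (by simp)

/-- A quarter-plane excursion, read as a sequence of operations of two stacks in parallel, sorts a
permutation. -/
theorem exists_twoStackSortable {n : ℕ} {w : List Step} (hl : w.length = 2 * n)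
    (hw : Returns w 0 0) : ∃ σ : {σ : Equiv.Perm (Fin n) // TwoStackSortable σ},
      TwoStackRun w (List.ofFn σ.1) (List.finRange n) [] [] [] [] := by
  have hc := hw.balanced.length_eq
  obtain ⟨h1, h2⟩ := (returns_iff w 0 0).1 hw
  obtain ⟨o, s', t', h⟩ := TwoStackRun.exists_of_prefix (w := w) (i := List.finRange n) (s := [])
    (t := []) (by simp at hc ⊢; omega) (by simpa using h2)
  have hst := h.length_stacks
  obtain rfl : t' = [] := List.length_eq_zero_iff.1 (by simp at hst h1; omega)
  obtain rfl : s' = [] := List.length_eq_zero_iff.1 (by simp at hst h1; omega)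
  obtain ⟨π, rfl⟩ := exists_perm_of_perm_finRange (by simpa using h.perm)
  have h' := h.map π.symm
  rw [← List.ofFn_eq_map, List.map_ofFn, Equiv.symm_comp_self, List.ofFn_id] at h'
  exact ⟨⟨π.symm, h'.reflTransGen []⟩, h'⟩

/-- Different standard eager quarter-plane excursions sort different permutations. -/
theorem card_le_numTwoStackSortable {ι : Type*} {n : ℕ} (g : ι → List Step)
    (hg : Function.Injective g) (hl : ∀ j, (g j).length = 2 * n) (hr : ∀ j, Returns (g j) 0 0)
    (hs : ∀ j, IsStandard (g j)) (he : ∀ j, IsEager (g j)) :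
    Nat.card ι ≤ numTwoStackSortable n := by
  choose f hf using fun j => exists_twoStackSortable (hl j) (hr j)
  refine Nat.card_le_card_of_injective f fun j k hjk => hg ?_
  have hk := hf k
  rw [← hjk] at hk
  -- Relabelled by `σ⁻¹`, the input elements come in increasing order.
  have h₁ := (hf j).map (f j).1.symm
  have h₂ := hk.map (f j).1.symm
  rw [List.map_ofFn, Equiv.symm_comp_self, List.ofFn_id] at h₁ h₂
  have hd : (List.finRange n ++ (([] : List (Fin n)) ++ [])).Nodup := by
    simpa using List.nodup_finRange n
  exact TwoStackRun.eq_of_isStandard (TwoStackRun.map_isInput_eq_of_isEager h₁ h₂ (by simp) hd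
    (he j) (he k)) h₁ h₂ (hs j) (hs k) (List.pairwise_lt_finRange n) hd

/-! ### Direct sums of sortable permutations -/

theorem reflTransGen_frame {α β : Type} (f : α → β) (i₀ o₀ : List β) {c c' : TwoStackConfig α}
    (h : Relation.ReflTransGen TwoStackStep c c') :
    Relation.ReflTransGen TwoStackStep
      (⟨c.input.map f ++ i₀, c.stack₁.map f, c.stack₂.map f, o₀ ++ c.output.map f⟩ :
        TwoStackConfig β)
      ⟨c'.input.map f ++ i₀, c'.stack₁.map f, c'.stack₂.map f, o₀ ++ c'.output.map f⟩ := by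
  refine Relation.ReflTransGen.lift (fun c : TwoStackConfig α =>
    (⟨c.input.map f ++ i₀, c.stack₁.map f, c.stack₂.map f, o₀ ++ c.output.map f⟩ :
      TwoStackConfig β)) ?_ _ _ h
  intro c c' hc
  cases hc with
  | I₁ a i s t o => exact .I₁ (f a) _ _ _ _
  | I₂ a i s t o => exact .I₂ (f a) _ _ _ _
  | O₁ a i s t o =>
    simpa [Function.onFun] using
      TwoStackStep.O₁ (f a) (i.map f ++ i₀) (s.map f) (t.map f) (o₀ ++ o.map f)
  | O₂ a i s t o =>
    simpa [Function.onFun] using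
      TwoStackStep.O₂ (f a) (i.map f ++ i₀) (s.map f) (t.map f) (o₀ ++ o.map f)

theorem TwoStackSortable.sum {m n : ℕ} {σ : Equiv.Perm (Fin m)} {τ : Equiv.Perm (Fin n)}
    (hσ : TwoStackSortable σ) (hτ : TwoStackSortable τ) :
    TwoStackSortable (finSumFinEquiv.permCongr (Equiv.Perm.sumCongr σ τ)) := by
  have hadd {k : Fin (m + n) → Fin (m + n)} : List.ofFn k =
      List.ofFn (fun i => k (Fin.castAdd n i)) ++ List.ofFn (fun i => k (Fin.natAdd m i)) :=
    List.ofFn_add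
  have e : List.ofFn (finSumFinEquiv.permCongr (Equiv.Perm.sumCongr σ τ)) =
      (List.ofFn σ).map (Fin.castAdd n) ++ (List.ofFn τ).map (Fin.natAdd m) := by
    rw [hadd]
    simp [Equiv.permCongr_apply, List.map_ofFn, Function.comp_def]
  have e' : List.finRange (m + n) =
      (List.finRange m).map (Fin.castAdd n) ++ (List.finRange n).map (Fin.natAdd m) := by
    rw [← List.ofFn_id, hadd]
    simp [← List.ofFn_eq_map]
  have h₁ := reflTransGen_frame (Fin.castAdd n) ((List.ofFn τ).map (Fin.natAdd m)) [] hσ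
  have h₂ := reflTransGen_frame (Fin.natAdd m) [] ((List.finRange m).map (Fin.castAdd n)) hτ
  rw [TwoStackSortable, e, e']
  exact Relation.ReflTransGen.trans (by simpa using h₁) (by simpa using h₂)

theorem numTwoStackSortable_mul_le (m n : ℕ) :
    numTwoStackSortable m * numTwoStackSortable n ≤ numTwoStackSortable (m + n) := by
  rw [numTwoStackSortable, numTwoStackSortable, ← Nat.card_prod]
  refine Nat.card_le_card_of_injective (fun p => ⟨_, p.1.2.sum p.2.2⟩) ?_
  rintro ⟨⟨σ, hσ⟩, ⟨τ, hτ⟩⟩ ⟨⟨σ', hσ'⟩, ⟨τ', hτ'⟩⟩ h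
  have h1 := finSumFinEquiv.permCongr.injective (Subtype.ext_iff.1 h)
  have h2 := Equiv.Perm.sumCongrHom_injective (a₁ := (σ, τ)) (a₂ := (σ', τ')) h1
  simp_all

theorem exists_twoStackRun_self {α : Type*} (l : List α) :
    ∃ w, TwoStackRun w l l [] [] [] [] := by
  induction l with
  | nil => exact ⟨[], rfl, rfl, rfl, rfl⟩
  | cons a l ih =>
    obtain ⟨w, h⟩ := ih
    exact ⟨.N :: .S :: w, _, _, rfl, _, _, _, rfl, rfl, h⟩

theorem numTwoStackSortable_pos (n : ℕ) : 0 < numTwoStackSortable n := by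
  obtain ⟨w, h⟩ := exists_twoStackRun_self (List.finRange n)
  have : TwoStackSortable (1 : Equiv.Perm (Fin n)) := by
    have h' := h.reflTransGen []
    rw [← List.ofFn_id] at h'
    rwa [TwoStackSortable, ← List.ofFn_id]
  exact Nat.card_pos_iff.2 ⟨⟨⟨1, this⟩⟩, inferInstance⟩

/-! ### Reflection of big-walks -/

theorem abs_endpoint_le (w : List Step) :
    |(endpoint w).1| ≤ w.length ∧ |(endpoint w).2| ≤ w.length := by
  simp only [abs_le]
  induction w with
  | nil => simp
  | cons x w ih =>
    cases x <;> simp only [endpoint_cons, Step.vec, Prod.fst_add, Prod.snd_add,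
      List.length_cons] <;> push_cast <;> omega

/-- The big-walks of half-length `m` that end to the right of the origin and those that end to the
left of it correspond to each other: reflect the walk and make the result standard again. The walk is
recovered from its effect on two stacks that are so large that they never become empty. -/
theorem exists_reflection (m : ℕ) : ∃ Φ : List Step → List Step,
    (∀ w, w.length = 2 * m → IsBigWalk w → (Φ w).length = 2 * m ∧ IsBigWalk (Φ w) ∧
      (endpoint (Φ w)).1 = -(endpoint w).1) ∧
    ∀ w₁ w₂, w₁.length = 2 * m → IsBigWalk w₁ → w₂.length = 2 * m → IsBigWalk w₂ →
      Φ w₁ = Φ w₂ → w₁ = w₂ := by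
  let i := List.range m
  let s := List.range' m (2 * m)
  let t := List.range' (3 * m) (2 * m)
  have hd : (i ++ (s ++ t)).Nodup := by
    simp only [i, s, t, List.nodup_append, List.nodup_range, List.mem_range, List.mem_append,
      List.mem_range'_1, true_and]
    grind
  have hd' : (i ++ (t ++ s)).Nodup :=
    (List.Perm.append_left i List.perm_append_comm).nodup_iff.1 hd
  have hi : i.Pairwise (· < ·) := List.pairwise_lt_range
  have key (w : List Step) : ∃ w', w.length = 2 * m → IsBigWalk w → w'.length = 2 * m ∧
      IsBigWalk w' ∧ (endpoint w').1 = -(endpoint w).1 ∧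
      w'.map Step.isInput = w.map Step.isInput ∧ ∃ o s' t', TwoStackRun w i o t s s' t' ∧
        TwoStackRun w' i o s t t' s' := by
    by_cases hw : w.length = 2 * m ∧ IsBigWalk w
    swap
    · exact ⟨w, fun h1 h2 => absurd ⟨h1, h2⟩ hw⟩
    obtain ⟨hl, hw⟩ := hw
    obtain ⟨hb, hs, he⟩ := (isBigWalk_iff w).1 hw
    obtain ⟨o, s', t', h⟩ := TwoStackRun.exists_of_prefix (w := w) (i := i) (s := t) (t := s)
      (by have := hb.length_eq; simp at this; simp [i]; omega) (by
        intro u hu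
        have h1 := abs_endpoint_le u
        have h2 := hu.length_le
        simp only [abs_le] at h1
        simp only [s, t, List.length_range']
        omega)
    obtain ⟨w', hs', hio, h'⟩ := h.flip.exists_isStandard
    rw [map_isInput_flip] at hio
    refine ⟨w', fun _ _ => ⟨?_, (isBigWalk_iff w').2 ⟨hio ▸ hb, hs', ?_⟩, ?_, hio, o, s', t', h, h'⟩⟩
    · rw [← hl]
      simpa using congrArg List.length hio
    · exact h.isEager_of_map_isInput_eq h' List.perm_append_comm hd' hio.symm he
    · have h1 := h.length_stacks
      have h2 := h'.length_stacks
      have h3 := hw.ends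
      simp only [s, t, List.length_range'] at h1 h2
      omega
  choose Φ hΦ using key
  refine ⟨Φ, fun w h1 h2 => ?_, fun w₁ w₂ h1 h2 h3 h4 e => ?_⟩
  · obtain ⟨a, b, c, -⟩ := hΦ w h1 h2
    exact ⟨a, b, c⟩
  · obtain ⟨-, -, -, hio₁, o₁, s₁, t₁, r₁, r₁'⟩ := hΦ w₁ h1 h2
    obtain ⟨-, -, -, hio₂, o₂, s₂, t₂, r₂, r₂'⟩ := hΦ w₂ h3 h4
    rw [e] at r₁' hio₁
    obtain ⟨rfl, rfl, rfl⟩ := r₁'.unique r₂'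
    exact TwoStackRun.eq_of_isStandard (hio₁.symm.trans hio₂) r₁ r₂ h2.standard h4.standard hi hd'

/-! ### Quarter-plane excursions composed of big-walks -/

/-- The concatenation of a walk of each index in a list, taken from the family `A` when the current
point `(x, y)` is above the diagonal and from the family `B` otherwise, followed by a way back to the
origin. -/
def steer {ι : Type*} (A B : ι → List Step) : List ι → ℕ → ℕ → List Step
  | [], x, y => List.replicate x .W ++ List.replicate y .S
  | j :: l, x, y =>
    (if x ≤ y then A j else B j) ++
      steer A B l (x + (endpoint (if x ≤ y then A j else B j)).1).toNat
        (y + (endpoint (if x ≤ y then A j else B j)).2).toNat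

theorem Returns.append_of_length_le {b z : List Step} {x y : ℕ} (hx : b.length ≤ x)
    (hy : b.length ≤ y)
    (hz : Returns z (x + (endpoint b).1).toNat (y + (endpoint b).2).toNat) :
    Returns (b ++ z) x y := by
  induction b generalizing x y with
  | nil => simpa using hz
  | cons a b ih =>
    simp only [List.length_cons] at hx hy
    cases a <;> simp only [List.cons_append, Returns] <;>
      simp only [endpoint_cons, Step.vec, Prod.fst_add, Prod.snd_add] at hz
    · refine ih (by omega) (by omega) ?_
      convert hz using 2 <;> omega
    · refine ih (by omega) (by omega) ?_
      convert hz using 2 <;> omega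
    · refine ⟨y - 1, by omega, ih (by omega) (by omega) ?_⟩
      convert hz using 2 <;> omega
    · refine ⟨x - 1, by omega, ih (by omega) (by omega) ?_⟩
      convert hz using 2 <;> omega

theorem returns_replicate (x y : ℕ) :
    Returns (List.replicate x .W ++ List.replicate y .S) x y := by
  induction x with
  | zero =>
    induction y with
    | zero => exact ⟨rfl, rfl⟩
    | succ y ih => exact ⟨y, rfl, by simpa using ih⟩
  | succ x ih => exact ⟨x, rfl, ih⟩

theorem isStandard_of_isInput_eq_false {w : List Step} (h : ∀ a ∈ w, a.isInput = false) :
    IsStandard w := by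
  induction w with
  | nil => exact isStandard_nil
  | cons a w ih =>
    rw [isStandard_cons]
    refine ⟨?_, ih fun b hb => h b (List.mem_cons_of_mem _ hb)⟩
    rintro rfl
    simpa [Step.isInput] using h .E List.mem_cons_self

theorem isEager_of_isInput_eq_false {w : List Step} (h : ∀ a ∈ w, a.isInput = false) :
    IsEager w := by
  induction w with
  | nil => exact isEager_nil
  | cons a w ih =>
    rw [isEager_cons]
    have := h a List.mem_cons_self
    refine ⟨?_, ih fun b hb => h b (List.mem_cons_of_mem _ hb)⟩
    cases a <;> simp [Step.isInput] at this ⊢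

section Steer

variable {ι : Type*} {A B : ι → List Step} {m : ℕ}

theorem steer_isStandard (hA : ∀ j, IsBigWalk (A j)) (hB : ∀ j, IsBigWalk (B j)) (l : List ι)
    (x y : ℕ) : IsStandard (steer A B l x y) := by
  induction l generalizing x y with
  | nil =>
    refine isStandard_of_isInput_eq_false fun a ha => ?_
    rcases List.mem_append.1 ha with h | h <;> rw [List.eq_of_mem_replicate h] <;> rfl
  | cons j l ih =>
    have h : IsBigWalk (if x ≤ y then A j else B j) := by split_ifs; exacts [hA j, hB j]
    exact isStandard_append_of_balanced ((isBigWalk_iff _).1 h).1 h.standard (ih _ _)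

theorem steer_isEager (hA : ∀ j, IsBigWalk (A j)) (hB : ∀ j, IsBigWalk (B j)) (l : List ι)
    (x y : ℕ) : IsEager (steer A B l x y) := by
  induction l generalizing x y with
  | nil =>
    refine isEager_of_isInput_eq_false fun a ha => ?_
    rcases List.mem_append.1 ha with h | h <;> rw [List.eq_of_mem_replicate h] <;> rfl
  | cons j l ih =>
    have h : IsBigWalk (if x ≤ y then A j else B j) := by split_ifs; exacts [hA j, hB j]
    exact isEager_append_of_balanced ((isBigWalk_iff _).1 h).1 h.eager (ih _ _)

theorem steer_injective (hA : Function.Injective A) (hB : Function.Injective B)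
    (hlA : ∀ j, (A j).length = 2 * m) (hlB : ∀ j, (B j).length = 2 * m) {l l' : List ι} {x y : ℕ}
    (hl : l.length = l'.length) (h : steer A B l x y = steer A B l' x y) : l = l' := by
  induction l generalizing l' x y with
  | nil => exact (List.length_eq_zero_iff.1 hl.symm).symm
  | cons j l ih =>
    cases l' with
    | nil => simp at hl
    | cons j' l' =>
      simp only [steer] at h
      obtain ⟨h1, h2⟩ := List.append_inj h (by split_ifs <;> simp [hlA, hlB])
      have e : j = j' := by
        split_ifs at h1
        exacts [hA h1, hB h1]
      subst e
      rw [ih (by simpa using hl) h2]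

/-- At the ends of its blocks, the steered walk remains among the points of the line `x + y = 8m` with
both coordinates at least `2m`, so it does not leave the quarter plane inside its blocks. -/
theorem steer_returns (hA : ∀ j, IsBigWalk (A j)) (hB : ∀ j, IsBigWalk (B j))
    (hlA : ∀ j, (A j).length = 2 * m) (hlB : ∀ j, (B j).length = 2 * m)
    (hA' : ∀ j, 0 ≤ (endpoint (A j)).1) (hB' : ∀ j, (endpoint (B j)).1 ≤ 0) (l : List ι)
    {x y : ℕ} (hxy : x + y = 8 * m) (hx : 2 * m ≤ x) (hy : 2 * m ≤ y) :
    Returns (steer A B l x y) x y ∧ (steer A B l x y).length = 2 * m * l.length + 8 * m := by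
  induction l generalizing x y with
  | nil => exact ⟨returns_replicate x y, by simp [steer, hxy]⟩
  | cons j l ih =>
    simp only [steer]
    obtain ⟨b, hb⟩ : ∃ b, b = if x ≤ y then A j else B j := ⟨_, rfl⟩
    rw [← hb]
    have hl : b.length = 2 * m := by rw [hb]; split_ifs <;> simp [hlA, hlB]
    have hw : IsBigWalk b := by rw [hb]; split_ifs; exacts [hA j, hB j]
    have h1 := abs_endpoint_le b
    simp only [abs_le, hl] at h1
    have h2 := hw.ends
    have h3 : 2 * (m : ℤ) ≤ x + (endpoint b).1 ∧ 2 * (m : ℤ) ≤ y + (endpoint b).2 := by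
      by_cases h : x ≤ y
      · have := hA' j
        rw [if_pos h] at hb
        rw [← hb] at this
        omega
      · have := hB' j
        rw [if_neg h] at hb
        rw [← hb] at this
        omega
    obtain ⟨h4, h5⟩ := ih (x := (x + (endpoint b).1).toNat) (y := (y + (endpoint b).2).toNat)
      (by omega) (by omega) (by omega)
    refine ⟨Returns.append_of_length_le (by omega) (by omega) h4, ?_⟩
    rw [List.length_append, h5, hl, List.length_cons]
    ring

end Steer

/-- The walk `z` preceded by a standard eager walk from the origin to the point `(k, k)`, whose final
dip `NSS` prevents its east steps from beginning a quarter-plane subloop, whatever `z` is. -/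
def ramp (k : ℕ) (z : List Step) : List Step :=
  List.replicate (k + 1) .N ++ (List.replicate k .E ++ .N :: .S :: .S :: z)

theorem returns_replicate_N_append {k x y : ℕ} {z : List Step} (h : Returns z x (y + k)) :
    Returns (List.replicate k .N ++ z) x y := by
  induction k generalizing y with
  | zero => exact h
  | succ k ih => exact ih (y := y + 1) (by convert h using 1; omega)

theorem returns_replicate_E_append {k x y : ℕ} {z : List Step} (h : Returns z (x + k) y) :
    Returns (List.replicate k .E ++ z) x y := by
  induction k generalizing x with
  | zero => exact h
  | succ k ih => exact ih (x := x + 1) (by convert h using 1; omega)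

theorem returns_ramp {k : ℕ} {z : List Step} (h : Returns z k k) : Returns (ramp k z) 0 0 :=
  returns_replicate_N_append (returns_replicate_E_append
    ⟨0 + (k + 1), rfl, 0 + k, rfl, by simpa using h⟩)

theorem length_ramp (k : ℕ) (z : List Step) : (ramp k z).length = 2 * k + 4 + z.length := by
  simp [ramp]; omega

theorem ramp_injective (k : ℕ) : Function.Injective (ramp k) := by
  intro z z' h
  simpa [ramp] using h

theorem not_returns_replicate_E {k x : ℕ} {v z : List Step}
    (hv : v <+: List.replicate k .E ++ .N :: .S :: .S :: z) : ¬ Returns v (x + 1) 0 := by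
  intro h
  induction k generalizing x v with
  | zero =>
    match v with
    | [] => simp [Returns] at h
    | [a] => cases a <;> simp_all [Returns]
    | [a, b] => cases a <;> cases b <;> simp_all [Returns]
    | a :: b :: c :: v =>
      simp only [List.replicate_zero, List.nil_append, List.cons_prefix_cons] at hv
      obtain ⟨rfl, rfl, rfl, -⟩ := hv
      simp [Returns] at h
  | succ k ih =>
    cases v with
    | nil => simp [Returns] at h
    | cons a v =>
      rw [List.replicate_succ, List.cons_append, List.cons_prefix_cons] at hv
      obtain ⟨rfl, hv'⟩ := hv
      exact ih hv' h

theorem isStandard_ramp {k : ℕ} {z : List Step} (h : IsStandard z) : IsStandard (ramp k z) := by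
  have h1 (k : ℕ) : IsStandard (List.replicate k .E ++ .N :: .S :: .S :: z) := by
    induction k with
    | zero => simpa [isStandard_cons] using h
    | succ k ih =>
      rw [List.replicate_succ, List.cons_append, isStandard_cons]
      exact ⟨fun _ v hv => not_returns_replicate_E hv, ih⟩
  have h2 (k : ℕ) {z : List Step} (h : IsStandard z) : IsStandard (List.replicate k .N ++ z) := by
    induction k with
    | zero => exact h
    | succ k ih =>
      rw [List.replicate_succ, List.cons_append, isStandard_cons]
      exact ⟨by simp, ih⟩
  exact h2 _ (h1 _)

theorem isEager_ramp {k : ℕ} {z : List Step} (h : IsEager z) : IsEager (ramp k z) := by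
  have h1 (k : ℕ) : IsEager (List.replicate k .E ++ .N :: .S :: .S :: z) := by
    induction k with
    | zero => simpa [isEager_cons] using h
    | succ k ih =>
      rw [List.replicate_succ, List.cons_append, isEager_cons]
      refine ⟨?_, ih⟩
      cases k <;> simp [List.replicate_succ]
  have h2 (j : ℕ) : IsEager (List.replicate j .N ++
      (List.replicate k .E ++ .N :: .S :: .S :: z)) := by
    induction j with
    | zero => exact h1 k
    | succ j ih =>
      rw [List.replicate_succ, List.cons_append, isEager_cons]
      refine ⟨?_, ih⟩
      cases j <;> cases k <;> simp [List.replicate_succ]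
  exact h2 _

/-- Up to constants, the big-walks of half-length `m` grow at most like sortable permutations: at least
half of them end on one side of the origin, and sequences of `M` of them, reflected where this is
needed to stay near the diagonal, can be completed to quarter-plane excursions. -/
theorem exists_pow_le_numTwoStackSortable (m : ℕ) : ∃ c : ℕ, numBigWalks m ≤ 2 * c ∧
    ∀ M, c ^ M ≤ numTwoStackSortable (m * M + (8 * m + 2)) := by
  obtain ⟨Φ, hΦ, hinj⟩ := exists_reflection m
  let ι := {w : {w : List Step // w.length = 2 * m ∧ IsBigWalk w} // 0 ≤ (endpoint w.1).1}
  refine ⟨Nat.card ι, ?_, fun M => ?_⟩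
  · rw [two_mul, ← Nat.card_sum, numBigWalks]
    let f (w : {w : List Step // w.length = 2 * m ∧ IsBigWalk w}) : ι ⊕ ι :=
      if h : 0 ≤ (endpoint w.1).1 then .inl ⟨w, h⟩
      else .inr ⟨⟨Φ w.1, (hΦ w.1 w.2.1 w.2.2).1, (hΦ w.1 w.2.1 w.2.2).2.1⟩, by
        rw [(hΦ w.1 w.2.1 w.2.2).2.2]; omega⟩
    refine Nat.card_le_card_of_injective f fun w w' h => ?_
    simp only [f] at h
    split_ifs at h
    · exact congrArg Subtype.val (Sum.inl.inj h)
    · exact Subtype.ext (hinj _ _ w.2.1 w.2.2 w'.2.1 w'.2.2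
        (congrArg (fun v : ι => v.1.1) (Sum.inr.inj h)))
  · let A (w : ι) : List Step := w.1.1
    let B (w : ι) : List Step := Φ w.1.1
    have hA (w : ι) := w.1.2.2
    have hlA (w : ι) := w.1.2.1
    have hB (w : ι) : IsBigWalk (B w) := (hΦ w.1.1 (hlA w) (hA w)).2.1
    have hlB (w : ι) : (B w).length = 2 * m := (hΦ w.1.1 (hlA w) (hA w)).1
    have hB' (w : ι) : (endpoint (B w)).1 ≤ 0 := by
      have := w.2
      simp only [B]
      rw [(hΦ w.1.1 (hlA w) (hA w)).2.2]
      omega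
    have hAi : Function.Injective A := Subtype.val_injective.comp Subtype.val_injective
    have hBi : Function.Injective B := fun w w' h =>
      Subtype.ext (Subtype.ext (hinj _ _ (hlA w) (hA w) (hlA w') (hA w') h))
    have hret (l : List ι) := steer_returns hA hB hlA hlB (fun w => w.2) hB' l
      (x := 4 * m) (y := 4 * m) (by omega) (by omega) (by omega)
    rw [← Nat.card_fin M, ← Nat.card_fun, Nat.card_fin]
    refine card_le_numTwoStackSortable
      (fun l : Fin M → ι => ramp (4 * m) (steer A B (List.ofFn l) (4 * m) (4 * m)))
      (fun l l' h => ?_) (fun l => ?_) (fun l => returns_ramp (hret _).1)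
      (fun l => isStandard_ramp (steer_isStandard hA hB _ _ _))
      (fun l => isEager_ramp (steer_isEager hA hB _ _ _))
    · exact List.ofFn_injective
        (steer_injective hAi hBi hlA hlB (by simp) (ramp_injective _ h))
    · rw [length_ramp, (hret _).2, List.length_ofFn]
      ring

/-! ### Growth rates -/

theorem numBigWalks_le (n : ℕ) : numBigWalks n ≤ 16 ^ n := by
  have h : Nat.card {w : List Step // w.length = 2 * n ∧ IsBigWalk w} ≤
      Nat.card (Fin (2 * n) → Fin 4) := by
    refine Nat.card_le_card_of_injective (fun w k =>
      ⟨(w.1[(k : ℕ)]'(by rw [w.2.1]; exact k.2)).code, ?_⟩) ?_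
    · cases w.1[(k : ℕ)]'(by rw [w.2.1]; exact k.2) <;> simp [Step.code]
    · intro w w' h
      refine Subtype.ext (List.ext_getElem (by rw [w.2.1, w'.2.1]) fun k hk hk' => ?_)
      have := congrFun h ⟨k, by rw [← w.2.1]; exact hk⟩
      exact Step.code_injective (by simpa using this)
  refine h.trans (le_of_eq ?_)
  rw [Nat.card_fun, Nat.card_fin, Nat.card_fin, pow_mul]
  norm_num

/-- Fekete's lemma for supermultiplicative sequences of exponential growth. -/
theorem exists_tendsto_of_supermultiplicative {a : ℕ → ℕ} {C : ℝ} (hpos : ∀ n, 0 < a n)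
    (hmul : ∀ m n, a m * a n ≤ a (m + n)) (hC : 1 ≤ C) (hle : ∀ n, (a n : ℝ) ≤ C ^ n) :
    ∃ μ : ℝ, 0 < μ ∧
      Filter.Tendsto (fun n : ℕ => (a n : ℝ) ^ (1 / (n : ℝ))) Filter.atTop (nhds μ) ∧
      ∀ n, (a n : ℝ) ≤ μ ^ n := by
  have hpos' (n : ℕ) : (0 : ℝ) < a n := by exact_mod_cast hpos n
  let u (n : ℕ) : ℝ := -Real.log (a n)
  have hu : Subadditive u := by
    intro m n
    have h : Real.log (a m * a n) ≤ Real.log (a (m + n)) :=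
      Real.log_le_log (mul_pos (hpos' m) (hpos' n)) (by exact_mod_cast hmul m n)
    rw [Real.log_mul (hpos' m).ne' (hpos' n).ne'] at h
    simp only [u]
    linarith
  have hlog (n : ℕ) : Real.log (a n) ≤ n * Real.log C := by
    rw [← Real.log_pow]
    exact Real.log_le_log (hpos' n) (hle n)
  have hb : BddBelow (Set.range fun n : ℕ => u n / n) := by
    refine ⟨-Real.log C, ?_⟩
    rintro _ ⟨n, rfl⟩
    rcases Nat.eq_zero_or_pos n with rfl | hn
    · simpa using Real.log_nonneg hC
    · have hn' : (0 : ℝ) < n := by exact_mod_cast hn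
      rw [le_div_iff₀ hn']
      have := hlog n
      simp only [u]
      linarith
  refine ⟨Real.exp (-hu.lim), Real.exp_pos _, ?_, fun n => ?_⟩
  · refine ((Real.continuous_exp.tendsto _).comp (hu.tendsto_lim hb).neg).congr fun n => ?_
    rw [Real.rpow_def_of_pos (hpos' n)]
    simp only [Function.comp_apply, u]
    congr 1
    ring
  · rcases eq_or_ne n 0 with rfl | hn
    · simpa using hle 0
    · have h := hu.lim_le_div hb hn
      have hn' : (0 : ℝ) < n := by exact_mod_cast Nat.pos_of_ne_zero hn
      rw [le_div_iff₀ hn'] at h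
      rw [← Real.exp_nat_mul, ← Real.log_le_iff_le_exp (hpos' n)]
      simp only [u] at h
      linarith

theorem le_of_forall_pow_le {c q K : ℝ} (hq : 0 < q) (h : ∀ M : ℕ, c ^ M ≤ q ^ M * K) : c ≤ q := by
  by_contra! hc
  obtain ⟨M, hM⟩ := pow_unbounded_of_one_lt K ((one_lt_div hq).2 hc)
  rw [div_pow, lt_div_iff₀ (pow_pos hq M)] at hM
  have := h M
  linarith

/-- A sequence between `p` and a constant multiple of `μ ^ n` has the growth rate `μ` if `p` has. -/
theorem tendsto_rpow_of_le_of_le {p a : ℕ → ℕ} {μ C : ℝ} (hμ : 0 < μ) (hC : 0 < C)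
    (hp : Filter.Tendsto (fun n : ℕ => (p n : ℝ) ^ (1 / (n : ℝ))) Filter.atTop (nhds μ))
    (hpa : ∀ n, p n ≤ a n) (ha : ∀ n, (a n : ℝ) ≤ C * μ ^ n) :
    Filter.Tendsto (fun n : ℕ => (a n : ℝ) ^ (1 / (n : ℝ))) Filter.atTop (nhds μ) := by
  have hlim : Filter.Tendsto (fun n : ℕ => C ^ (1 / (n : ℝ)) * μ) Filter.atTop (nhds μ) := by
    have h := ((Real.continuous_const_rpow hC.ne').tendsto 0).comp
      (tendsto_one_div_atTop_nhds_zero_nat (𝕜 := ℝ))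
    simpa using h.mul_const μ
  refine tendsto_of_tendsto_of_tendsto_of_le_of_le' hp hlim ?_ ?_
  · exact Filter.Eventually.of_forall fun n =>
      Real.rpow_le_rpow (Nat.cast_nonneg _) (by exact_mod_cast hpa n) (by positivity)
  · filter_upwards [Filter.eventually_ne_atTop 0] with n hn
    refine (Real.rpow_le_rpow (Nat.cast_nonneg _) (ha n) (by positivity)).trans (le_of_eq ?_)
    rw [Real.mul_rpow hC.le (by positivity), one_div, Real.pow_rpow_inv_natCast hμ.le hn]

end SortingMachines

theorem theorem1 :
    ∃ μ : ℝ,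
      Filter.Tendsto (fun n : ℕ => (SortingMachines.numTwoStackSortable n : ℝ) ^ (1 / (n : ℝ)))
        Filter.atTop (nhds μ) ∧
      Filter.Tendsto (fun n : ℕ => (SortingMachines.numDequeSortable n : ℝ) ^ (1 / (n : ℝ)))
        Filter.atTop (nhds μ) ∧
      Filter.Tendsto (fun n : ℕ => (SortingMachines.numBigWalks n : ℝ) ^ (1 / (n : ℝ)))
        Filter.atTop (nhds μ) := by
  open SortingMachines in
  have hpd := numTwoStackSortable_le_numDequeSortable
  have hdb := numDequeSortable_le_numBigWalks
  obtain ⟨μ, hμ, hlim, hle⟩ := exists_tendsto_of_supermultiplicative (C := 16)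
    numTwoStackSortable_pos numTwoStackSortable_mul_le (by norm_num) fun n => by
      exact_mod_cast ((hpd n).trans (hdb n)).trans (numBigWalks_le n)
  have hb (n : ℕ) : (numBigWalks n : ℝ) ≤ 2 * μ ^ n := by
    obtain ⟨c, hc, hpow⟩ := exists_pow_le_numTwoStackSortable n
    have h : (c : ℝ) ≤ μ ^ n := by
      refine le_of_forall_pow_le (K := μ ^ (8 * n + 2)) (pow_pos hμ n) fun M => ?_
      rw [← pow_mul, ← pow_add]
      exact le_trans (by exact_mod_cast hpow M) (hle _)
    have hc' : (numBigWalks n : ℝ) ≤ 2 * c := by exact_mod_cast hc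
    linarith
  have hd (n : ℕ) : (numDequeSortable n : ℝ) ≤ 2 * μ ^ n :=
    le_trans (by exact_mod_cast hdb n) (hb n)
  exact ⟨μ, hlim, tendsto_rpow_of_le_of_le hμ two_pos hlim hpd hd,
    tendsto_rpow_of_le_of_le hμ two_pos hlim (fun n => (hpd n).trans (hdb n)) hb⟩
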